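/- **Conventions.** A hypergraph on a finite vertex set $V$ is a finite set $E$ of subsets of $V$; $\log$ is the natural logarithm. For $X\subseteq V$ and $j\ge 0$ let $N_j(X)=\{Y\subseteq V-X : X\cup Y\in E,\ |Y|=j\}$ and $D_j(X)=|N_j(X)|$. The residual graph of $E$ with respect to $I\subseteq V$ consists of the inclusion-minimal members of $\{\{u\}:u\in I\}\cup\{e-I : e\in E\}$. Put $g(l)=2^{l+2}-9$. Given $m$ and a rank bound $r$, a hypergraph is *$v$-constrained* if $D_j(X)\le v^j(\log m)^{-g(j+|X|)}$ for all $X\subseteq V$ with $0<|X|<r$ and all $j\ge 1$. **The algorithm DET-REDUCE.** The input is a hypergraph $G=(V,E)$ with $n$ vertices, $m$ edges and all edges of size at most $r$, a real $v>0$, and a probability distribution $\Omega$ on $\{0,1\}^V$. Let $s=\lceil\log_2 v\rceil$ (read as $0$ if $v<1$) and $T=\lfloor(\log m)^{2^{r+2}}\rfloor$. Put $G^0=G$, $I=\emptyset$. In round $t=0,\dots,T-1$ the bit-vectors $B^{t,1},\dots,B^{t,s}\in\{0,1\}^V$ are chosen one after the other: given all earlier bits, $B^{t,i+1}$ is an element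 of the support of $\Omega$ that minimizes over the support the potential $\Phi^{t,i+1}$ defined below (ties are broken arbitrarily). Let $C^{t,i}$ be the set of vertices $u$ with $B^{t,1}(u)=\dots=B^{t,i}(u)=1$; the marked set is $C^t=C^{t,s}$. Whenever an edge of $G^t$ is contained in $C^t$, all its vertices are unmarked; the vertices that remain marked are added to $I$, and $G^{t+1}$ is the residual graph of $G$ with respect to $I$. Write $D^t_j(X)$ and $N^t_j(X)$ for the quantities of $G^t$. **The potential.** $\Phi^{\ell,i}$ is the sum of the values at $(\ell,i)$ of the following summands. Throughout, $X$ ranges over the sets with $x=|X|$, $0<x<r$, that are contained in an edge of $G$. (S1) For $0\le t<T$, $1\le j<k\le r$, $q=k-j$, and $Y\subseteq V-X$ with $y=|Y|<q$ and $Y$ contained in an edge of $G$, let $w=\lceil 1000\log m/q\rceil$ and $$H^i(Y)=\sum_{\substack{Z\subseteq V-X,\ Z\supseteq Y\\ |Z|=q,\ Z\subseteq C^{t,i}}}D^t_j(X\cup Z).$$ The summand is $m^{-100}$ if $\ell<t$; it is $$4^{s-i}\Bigl(\frac{v^j(\log m)^{-g(k+x)+4(q-y)}+H^i(Y)2^{-(s-i)(q-y)}}{v^j(\log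 m)^{-g(k+x)+4(q-y)+1}}\Bigr)^w$$ if $\ell=t$; and if $\ell>t$ it is the value of this expression at $i=s$. (S2), (S3) For a time $t$, $k\ge1$, an integer $\tau$ and a real $\gamma$, put $c=2^{-k-1}v^{-k}\gamma$ and $$h^{\ell}=\sum_{Y\in N^{\ell}_k(X)}[Y\subseteq C^{\ell}]\Bigl(1-\sum_{e\in G^{\ell},\,e\cap Y\ne\emptyset}[e-Y\subseteq C^{\ell}]-\sum_{Y'\in N^{\ell}_k(X),\,Y'\ne Y}[Y'-Y\subseteq C^{\ell}]\Bigr),$$ and let $\phi^{\ell,i}$ be: for $\ell\ge t$, $1$ if $D^u_k(X)>\gamma$ for all $u\in\{t-\tau,\dots,t\}$ and $0$ otherwise; for $\ell<t-\tau$, $(1-c)^\tau$; for $t-\tau\le\ell<t$, $(1-\mathbf E[h^{\ell}])(1-c)^{t-\ell-1}$ if $D^u_k(X)>\gamma$ for all $u\in\{t-\tau,\dots,\ell\}$ and $0$ otherwise, where in $\mathbf E[h^\ell]$ the bits $B^{\ell,1},\dots,B^{\ell,i}$ are fixed and $B^{\ell,i+1},\dots,B^{\ell,s}$ are drawn independently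 from $\Omega$. The summands (S2) are the $\phi$ with $1\le k\le r-x$, $\tau=\lfloor(\log m)^{2^{k+x+2}-5.01}\rfloor$, $\gamma=v^k(\log m)^{-g(k+x)}$ and $\tau\le t\le T$. The summands (S3) are the $\phi$ with $1\le k\le r-x$, $\tau=\lfloor\frac12\,0.99^k(\log m)^{2^{k+x+2}-5.01}\rfloor$, $\gamma=\frac12(0.99v)^k(\log m)^{-g(k+x)}$ and $t=T$. **Theorem.** There are constants $L_0>0$ and $N_0$ such that the following holds whenever $n\ge N_0$, $m\ge n$, $2^r\le\frac{\log n}{\log\log n}$, $0<v\le m^3$, $G$ is $v$-constrained, and $\Omega$ satisfies - (Q1) for any $w\le L_0\log m$ distinct vertices $u_1,\dots,u_w$ and any $y\in\{0,1\}^w$, $P_{b\sim\Omega}(b_{u_1}=y_1\wedge\dots\wedge b_{u_w}=y_w)\le 2\cdot2^{-w}$; - (Q2) for any edges $e,e'$ of $G$ and any $S\subseteq e\cup e'$, $P_{b\sim\Omega}(b_u=1\text{ for all }u\in S)=2^{-|S|}$. In every run of DET-REDUCE, for every $t\in\{0,\dots,T-1\}$, every $X\subseteq V$ with $|X|=x$,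 $0<x<r$, and every $j\ge1$, $$D_j^{t+1}(X)\le D_j^t(X)+v^j(\log m)^{-g(x+j+1)+5.01}.$$ -/

import Mathlib

/-! ### Hypergraphs, degrees, residual graphs

A hypergraph on a finite vertex type `V` is its finite set of edges, `E : Finset (Finset V)`. -/

section Hypergraph

variable {V : Type*} [Fintype V] [DecidableEq V]

/-- The `j`-neighbourhood `N_j(X) = {Y ⊆ V - X : X ∪ Y ∈ E, |Y| = j}`. -/
def nbhd (E : Finset (Finset V)) (j : ℕ) (X : Finset V) : Finset (Finset V) :=
  Finset.univ.filter fun Y => Disjoint X Y ∧ X ∪ Y ∈ E ∧ Y.card = j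

/-- The `j`-degree `D_j(X) = |N_j(X)|`. -/
def hdeg (E : Finset (Finset V)) (j : ℕ) (X : Finset V) : ℕ :=
  (nbhd E j X).card

/-- The residual graph before nested edges are removed: the singletons `{u}`, `u ∈ I`, and the
sets `e - I`, `e ∈ E`. -/
def preResidual (E : Finset (Finset V)) (I : Finset V) : Finset (Finset V) :=
  (I.image fun u => ({u} : Finset V)) ∪ E.image fun e => e \ I

/-- The residual graph of `E` with respect to `I`: an edge that strictly contains another one is
removed. -/
def residualGraph (E : Finset (Finset V)) (I : Finset V) : Finset (Finset V) :=
  (preResidual E I).filter fun e' => ∀ e ∈ preResidual E I, ¬ e ⊂ e'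

/-- The vertices that stay marked when, for every fully marked edge, all its vertices are
unmarked. -/
def stayMarked (E : Finset (Finset V)) (C : Finset V) : Finset V :=
  C.filter fun u => ∀ e ∈ E, u ∈ e → ¬ e ⊆ C

/-- `g(l) = 2^(l+2) - 9`. -/
def gExp (l : ℕ) : ℝ := 2 ^ (l + 2) - 9

/-- `v`-constrained hypergraphs (for the size parameter `m` and the rank bound `r`). -/
def IsConstrained (m r : ℕ) (E : Finset (Finset V)) (v : ℝ) : Prop :=
  ∀ X : Finset V, 0 < X.card → X.card < r → ∀ j : ℕ, 1 ≤ j →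
    (hdeg E j X : ℝ) ≤ v ^ j * Real.log m ^ (-gExp (j + X.card))

end Hypergraph

/-! ### The probability space of bit-vectors

A bit-vector indexed by `V` is identified with the set of vertices whose bit is `1`. -/

section Space

variable {V : Type*} [Fintype V] [DecidableEq V]

/-- The probability of an event under `Ω`. -/
noncomputable def bitProb (Ω : PMF (Finset V)) (A : Finset V → Prop) [DecidablePred A] : ℝ :=
  ∑ b with A b, (Ω b).toReal

/-- Approximate independence of up to `L` bits: every prescribed pattern on `w ≤ L` positions
has probability at most `2 * 2^(-w)`. The pattern on `W` is given by the set `y ⊆ W` of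
positions that carry a one. -/
def ApproxIndep (Ω : PMF (Finset V)) (L : ℝ) : Prop :=
  ∀ W y : Finset V, y ⊆ W → (W.card : ℝ) ≤ L →
    bitProb Ω (fun b => b ∩ W = y) ≤ 2 * (1 / 2) ^ W.card

/-- Exact independence inside the union of any two edges. -/
def EdgeIndep (Ω : PMF (Finset V)) (E : Finset (Finset V)) : Prop :=
  ∀ e ∈ E, ∀ e' ∈ E, ∀ S : Finset V, S ⊆ e ∪ e' →
    bitProb Ω (fun b => S ⊆ b) = (1 / 2) ^ S.card

/-- Let `C` be the set of vertices marked so far, and let `a` further bit-vectors be drawn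
independently from `Ω` and intersected with `C`. This is the expected value of `f` at the
resulting set. -/
noncomputable def expectMarks (Ω : PMF (Finset V)) (f : Finset V → ℝ) : ℕ → Finset V → ℝ
  | 0, C => f C
  | a + 1, C => ∑ b : Finset V, (Ω b).toReal * expectMarks Ω f a (C ∩ b)

end Space

/-! ### The algorithm DET-REDUCE -/

/-- The data of a call of DET-REDUCE: the input hypergraph, the rank bound `r`, the parameter `v`
and the probability space of bit-vectors. -/
structure DetInput (V : Type*) where
  edges : Finset (Finset V)
  r : ℕ
  v : ℝ
  Ω : PMF (Finset V)

namespace DetInput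

variable {V : Type*} [Fintype V] [DecidableEq V] (P : DetInput V)

/-- The number `m` of edges of the input hypergraph. -/
def m : ℕ := P.edges.card

/-- `log m`. -/
noncomputable def lm : ℝ := Real.log P.m

/-- The number of stages in a round, `s = ⌈log₂ v⌉`. -/
noncomputable def s : ℕ := ⌈Real.logb 2 P.v⌉₊

/-- The number of rounds, `T = (log m)^(2^(r+2))`, rounded down. -/
noncomputable def T : ℕ := ⌊P.lm ^ (2 ^ (P.r + 2))⌋₊

/-- `C^{t,i}`: the vertices whose bits in the first `i` stages of round `t` are all one. Here and
below `B t a` is the bit-vector chosen in round `t`, stage `a + 1`. -/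
def marks (B : ℕ → ℕ → Finset V) (t i : ℕ) : Finset V :=
  Finset.univ.filter fun u => ∀ a ∈ Finset.range i, u ∈ B t a

/-- The independent set `I` and the hypergraph `G^t` at time `t`. Round `t` turns `G^t` into
`G^{t+1}`, the residual graph of the input with respect to the enlarged independent set. -/
noncomputable def state (B : ℕ → ℕ → Finset V) : ℕ → Finset V × Finset (Finset V)
  | 0 => (∅, P.edges)
  | t + 1 =>
    let I := (state B t).1 ∪ stayMarked (state B t).2 (marks B t P.s)
    (I, residualGraph P.edges I)

/-- The hypergraph `G^t`. -/
noncomputable def graph (B : ℕ → ℕ → Finset V) (t : ℕ) : Finset (Finset V) := (P.state B t).2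

/-- `D_j^t(X)`. -/
noncomputable def D (B : ℕ → ℕ → Finset V) (t j : ℕ) (X : Finset V) : ℕ :=
  hdeg (P.graph B t) j X

/-! #### The potential summands (S1) -/

/-- `H^i(Y)`: the sum of `D_j^t(X ∪ Z)` over all `Z ⊆ V - X` with `Z ⊇ Y`, `|Z| = q` and
`C^{t,i}(Z)`. -/
noncomputable def H (B : ℕ → ℕ → Finset V) (t j q : ℕ) (X : Finset V) (i : ℕ) (Y : Finset V) : ℝ :=
  ∑ Z with Disjoint X Z ∧ Y ⊆ Z ∧ Z.card = q ∧ Z ⊆ marks B t i, (P.D B t j (X ∪ Z) : ℝ)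

/-- `w = ⌈1000 log m / q⌉`. -/
noncomputable def wExp (q : ℕ) : ℕ := ⌈1000 * P.lm / q⌉₊

/-- The summand `Ψ_{Y,t,k,j,X}` at round `l` and stage `i`, with `q = k - j`, `x = |X|` and
`y = |Y|`. -/
noncomputable def Psi (B : ℕ → ℕ → Finset V) (l i t k j : ℕ) (X Y : Finset V) : ℝ :=
  let q := k - j
  let d : ℕ := q - Y.card
  let base : ℝ := P.v ^ j * P.lm ^ (-gExp (k + X.card) + 4 * d)
  let den : ℝ := P.v ^ j * P.lm ^ (-gExp (k + X.card) + 4 * d + 1)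
  if l < t then ((P.m : ℝ) ^ 100)⁻¹
  else if l = t then
    4 ^ (P.s - i) *
      ((base + P.H B t j q X i Y * ((2 : ℝ) ^ ((P.s - i) * d))⁻¹) / den) ^ P.wExp q
  else ((base + P.H B t j q X P.s Y) / den) ^ P.wExp q

/-! #### The potential summands (S2) and (S3) -/

/-- The estimator `h(k, X)` of the event that `X` collapses, for the hypergraph `G` and the set
`C` of marked vertices. -/
noncomputable def collapseEst (G : Finset (Finset V)) (k : ℕ) (X C : Finset V) : ℝ :=
  ∑ Y ∈ nbhd G k X, (if Y ⊆ C then 1 else 0) *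
    (1 - (∑ e ∈ G with (e ∩ Y).Nonempty, if e \ Y ⊆ C then 1 else 0)
       - ∑ Y' ∈ (nbhd G k X).erase Y, if Y' \ Y ⊆ C then 1 else 0)

/-- The expectation of `h^l(k, X)` when the bits of the first `i` stages of round `l` are fixed
and those of the remaining stages are drawn independently from `Ω`. -/
noncomputable def expCollapse (B : ℕ → ℕ → Finset V) (l i k : ℕ) (X : Finset V) : ℝ :=
  expectMarks P.Ω (collapseEst (P.graph B l) k X) (P.s - i) (marks B l i)

/-- The summand `φ` (at round `l` and stage `i`) against the event that `D_k^u(X) > γ` for all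
times `u` in `{t - τ, …, t}`. -/
noncomputable def phi (B : ℕ → ℕ → Finset V) (l i : ℕ) (τ : ℕ) (γ : ℝ) (t k : ℕ)
    (X : Finset V) : ℝ :=
  let c : ℝ := γ / (2 ^ (k + 1) * P.v ^ k)
  if t ≤ l then (if ∀ u ∈ Finset.Icc (t - τ) t, γ < P.D B u k X then 1 else 0)
  else if l < t - τ then (1 - c) ^ τ
  else if ∀ u ∈ Finset.Icc (t - τ) l, γ < P.D B u k X then
    (1 - P.expCollapse B l i k X) * (1 - c) ^ (t - l - 1)
  else 0

/-- `τ₁ = (log m)^(2^(j+x+2) - 5.01)`, rounded down. -/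
noncomputable def tau1 (j x : ℕ) : ℕ := ⌊P.lm ^ ((2 : ℝ) ^ (j + x + 2) - 5.01)⌋₊

/-- `γ₁ = v^j (log m)^(-g(j+x))`. -/
noncomputable def gamma1 (j x : ℕ) : ℝ := P.v ^ j * P.lm ^ (-gExp (j + x))

/-- `τ₂ = (1/2) 0.99^j (log m)^(2^(j+x+2) - 5.01)`, rounded down. -/
noncomputable def tau2 (j x : ℕ) : ℕ :=
  ⌊1 / 2 * 0.99 ^ j * P.lm ^ ((2 : ℝ) ^ (j + x + 2) - 5.01)⌋₊

/-- `γ₂ = (1/2) (0.99 v)^j (log m)^(-g(j+x))`. -/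
noncomputable def gamma2 (j x : ℕ) : ℝ := 1 / 2 * (0.99 * P.v) ^ j * P.lm ^ (-gExp (j + x))

/-! #### The potential function and the choice of the bits -/

/-- The sets `X` with `0 < |X| < r` that lie in an edge of the input hypergraph. -/
def sets : Finset (Finset V) :=
  Finset.univ.filter fun X => 0 < X.card ∧ X.card < P.r ∧ ∃ e ∈ P.edges, X ⊆ e

/-- The sets `Y ⊆ V - X` with `|Y| < q` that lie in an edge of the input hypergraph. -/
def subsets (X : Finset V) (q : ℕ) : Finset (Finset V) :=
  Finset.univ.filter fun Y => Disjoint X Y ∧ Y.card < q ∧ ∃ e ∈ P.edges, Y ⊆ e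

/-- The potential `Φ^{l,i}`: the sum of all potential summands. It depends only on the bits of the
rounds before `l` and of the first `i` stages of round `l`. -/
noncomputable def potential (B : ℕ → ℕ → Finset V) (l i : ℕ) : ℝ :=
  (∑ t ∈ Finset.range P.T, ∑ X ∈ P.sets, ∑ k ∈ Finset.Icc 1 P.r, ∑ j ∈ Finset.Ico 1 k,
      ∑ Y ∈ P.subsets X (k - j), P.Psi B l i t k j X Y)
  + (∑ X ∈ P.sets, ∑ j ∈ Finset.Icc 1 (P.r - X.card), ∑ t ∈ Finset.Icc (P.tau1 j X.card) P.T,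
      P.phi B l i (P.tau1 j X.card) (P.gamma1 j X.card) t j X)
  + ∑ X ∈ P.sets, ∑ j ∈ Finset.Icc 1 (P.r - X.card),
      P.phi B l i (P.tau2 j X.card) (P.gamma2 j X.card) P.T j X

/-- The bits `B` with the bit-vector of round `t`, stage `a + 1` replaced by `b`. -/
def setBits (B : ℕ → ℕ → Finset V) (t a : ℕ) (b : Finset V) : ℕ → ℕ → Finset V :=
  Function.update B t (Function.update (B t) a b)

/-- `B` is the record of a run of DET-REDUCE: in every round `t < T` and every stage, the chosen
bit-vector lies in the support of `Ω` and minimizes there the potential of the next stage. (Ties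
may be broken in any way.) -/
def IsRun (B : ℕ → ℕ → Finset V) : Prop :=
  ∀ t < P.T, ∀ i < P.s, B t i ∈ P.Ω.support ∧
    ∀ b ∈ P.Ω.support, P.potential B t (i + 1) ≤ P.potential (setBits B t i b) t (i + 1)

end DetInput

set_option linter.unusedSectionVars false

/-! ### Degrees and residual graphs -/

section Hypergraph

variable {V : Type*} [Fintype V] [DecidableEq V]

/-! The algorithm is the method of conditional expectations. The proof carries two facts through the
rounds (`round_invariant`): at the start of a round the potential is below 1, and every degree is at
most three times `gamma1` (`DegBound`). Initially the potential is below 1 because it has about `m ^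
10` summands, each at most `m ^ (-100)` (`potential_zero_lt_one`).

Within a round, the average of the potential over the next bit-vector does not exceed its present
value (`avg_potential_le`), so neither does the minimum. The summands (S2) and (S3) keep their
expectation exactly. For (S1), the power is expanded and bounded by approximate independence
(`ApproxIndep.moment_le`); a stage loses a factor of at most 4, which the prefactor `4 ^ (s - i)`
pays for (`avg_Psi_current_le`). The expansion forces a few vertices to be marked, and their
influence on `H` is controlled by the summands (S1) of larger sets `Y`, themselves below 1.

At the end of a round, a potential below 1 bounds `H` at the empty set. A new edge arises from an
old one by deleting marked vertices (`D_succ_le`), so this bounds the growth of every degree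
(`D_succ_le_of_potential`), which is the claim.

It remains to maintain `DegBound`. A summand (S2) whose final time is reached is a 0/1 indicator,
hence zero: the degree was at most `gamma1` at some time in the last `tau1` rounds, and its growth
since then is at most twice `gamma1` (`degBound_succ`). Conversely, `DegBound` makes the (S1)
summands of the new round start small (`psi_zero_le`) and gives sets of large degree a good chance
to collapse (`rate_le_expCollapse`); so the potential does not increase between rounds
(`potential_round_le`). The summands (S3) do not enter the growth bound, but they belong to the
minimized sum and must be controlled with it.

If `v ≤ 1`, only edges with at most one vertex exist and all degrees in question vanish. -/

theorem Finset.sum_le_sum_of_injOn_maps {α β : Type*} [DecidableEq β] {s : Finset α} {t : Finset β}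
    {f : α → ℝ} {g : β → ℝ} (φ : α → β) (hmaps : ∀ a ∈ s, φ a ∈ t) (hinj : Set.InjOn φ s)
    (hle : ∀ a ∈ s, f a ≤ g (φ a)) (hg : ∀ b ∈ t, 0 ≤ g b) : ∑ a ∈ s, f a ≤ ∑ b ∈ t, g b := by
  calc ∑ a ∈ s, f a ≤ ∑ a ∈ s, g (φ a) := Finset.sum_le_sum hle
    _ = ∑ b ∈ s.image φ, g b := (Finset.sum_image hinj).symm
    _ ≤ ∑ b ∈ t, g b := by
        apply Finset.sum_le_sum_of_subset_of_nonneg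
        · intro b hb
          obtain ⟨a, ha, rfl⟩ := Finset.mem_image.1 hb
          exact hmaps a ha
        · intro b hb _
          exact hg b hb

theorem mem_nbhd {E : Finset (Finset V)} {j : ℕ} {X Y : Finset V} :
    Y ∈ nbhd E j X ↔ Disjoint X Y ∧ X ∪ Y ∈ E ∧ Y.card = j := by
  simp [nbhd]

theorem mem_preResidual {E : Finset (Finset V)} {I e : Finset V} :
    e ∈ preResidual E I ↔ (∃ u ∈ I, {u} = e) ∨ ∃ f ∈ E, f \ I = e := by
  simp [preResidual]

theorem exists_mem_residualGraph_subset {E : Finset (Finset V)} {I e : Finset V}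
    (he : e ∈ preResidual E I) : ∃ f ∈ residualGraph E I, f ⊆ e := by
  obtain ⟨f, hfe, hf⟩ := (preResidual E I).exists_le_minimal he
  refine ⟨f, ?_, hfe⟩
  rw [residualGraph, Finset.mem_filter]
  refine ⟨hf.prop, fun g hg hgf => ?_⟩
  exact hgf.2 (hf.le_of_le hg hgf.1)

theorem eq_of_subset_of_mem_residualGraph {E : Finset (Finset V)} {I e f : Finset V}
    (he : e ∈ preResidual E I) (hf : f ∈ residualGraph E I) (h : e ⊆ f) : e = f := by
  rw [residualGraph, Finset.mem_filter] at hf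
  by_contra hne
  exact hf.2 e he (Finset.ssubset_iff_subset_ne.2 ⟨h, hne⟩)

theorem stayMarked_subset (E : Finset (Finset V)) (C : Finset V) : stayMarked E C ⊆ C :=
  Finset.filter_subset _ _

/-- The extensions of `X ∪ Y` split off as `Z \ Y` and a `j`-neighbour of `X ∪ Z`. -/
theorem sum_hdeg_union_le (E : Finset (Finset V)) (j q : ℕ) (X Y : Finset V) (hY : Y.card ≤ q) :
    ∑ Z with Disjoint X Z ∧ Y ⊆ Z ∧ Z.card = q, (hdeg E j (X ∪ Z) : ℝ) ≤
      2 ^ (j + q - Y.card) * hdeg E (j + q - Y.card) (X ∪ Y) := by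
  set A : Finset (Finset V) := Finset.univ.filter fun Z => Disjoint X Z ∧ Y ⊆ Z ∧ Z.card = q
    with hA
  have h1 : ∑ Z ∈ A, (hdeg E j (X ∪ Z) : ℝ) =
      ∑ p ∈ A.sigma fun Z => nbhd E j (X ∪ Z), (1 : ℝ) := by
    rw [Finset.sum_sigma]
    simp [hdeg]
  have h2 : (2 : ℝ) ^ (j + q - Y.card) * hdeg E (j + q - Y.card) (X ∪ Y) =
      ∑ p ∈ (nbhd E (j + q - Y.card) (X ∪ Y)).sigma fun U => U.powerset, (1 : ℝ) := by
    rw [Finset.sum_sigma]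
    have : ∀ U ∈ nbhd E (j + q - Y.card) (X ∪ Y),
        ∑ _p ∈ U.powerset, (1 : ℝ) = 2 ^ (j + q - Y.card) := by
      intro U hU
      simp [(mem_nbhd.1 hU).2.2]
    rw [Finset.sum_congr rfl this]
    simp [hdeg, mul_comm]
  rw [h1, h2]
  -- A pair `(Z, W)` is recovered from the extension `(Z \ Y) ∪ W` of `X ∪ Y` once the part `Z \ Y`
  -- is known; choosing that part costs the power of 2.
  refine Finset.sum_le_sum_of_injOn_maps
    (fun p => (⟨(p.1 \ Y) ∪ p.2, p.1 \ Y⟩ : (_ : Finset V) × Finset V)) ?_ ?_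
    (fun _ _ => le_rfl) (fun _ _ => zero_le_one)
  · rintro ⟨Z, W⟩ hp
    simp only [Finset.mem_sigma, hA, Finset.mem_filter, Finset.mem_univ, true_and, mem_nbhd] at hp
    obtain ⟨⟨hXZ, hYZ, hZ⟩, hW, hE, hWj⟩ := hp
    simp only [Finset.mem_sigma, Finset.mem_powerset, mem_nbhd]
    rw [Finset.disjoint_union_left] at hW
    refine ⟨⟨?_, ?_, ?_⟩, Finset.subset_union_left⟩
    · rw [Finset.disjoint_union_left, Finset.disjoint_union_right, Finset.disjoint_union_right]
      exact ⟨⟨hXZ.mono_right Finset.sdiff_subset, hW.1⟩, Finset.disjoint_sdiff,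
        hW.2.mono_left hYZ⟩
    · convert hE using 1
      rw [← Finset.union_assoc, Finset.union_assoc X, Finset.union_sdiff_of_subset hYZ]
    · rw [Finset.card_union_of_disjoint (hW.2.mono_left Finset.sdiff_subset),
        Finset.card_sdiff_of_subset hYZ, hZ, hWj]
      omega
  · rintro ⟨Z, W⟩ hp ⟨Z', W'⟩ hp' heq
    simp only [Finset.coe_sigma, Set.mem_sigma_iff, Finset.mem_coe, hA, Finset.mem_filter,
      Finset.mem_univ, true_and, mem_nbhd, Finset.disjoint_union_left] at hp hp'
    simp only [Sigma.mk.injEq, heq_eq_eq] at heq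
    obtain ⟨⟨_, hYZ, _⟩, ⟨_, hW⟩, _⟩ := hp
    obtain ⟨⟨_, hYZ', _⟩, ⟨_, hW'⟩, _⟩ := hp'
    have hZ : Z = Z' := by
      rw [← Finset.union_sdiff_of_subset hYZ, ← Finset.union_sdiff_of_subset hYZ', heq.2]
    subst hZ
    have hWW : W = W' := by
      have a1 : (Z \ Y ∪ W) \ (Z \ Y) = W := by
        rw [Finset.union_sdiff_cancel_left (hW.mono_left Finset.sdiff_subset)]
      have a2 : (Z \ Y ∪ W') \ (Z \ Y) = W' := by
        rw [Finset.union_sdiff_cancel_left (hW'.mono_left Finset.sdiff_subset)]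
      rw [← a1, ← a2, heq.1]
    subst hWW
    rfl

end Hypergraph

/-! ### One round of the algorithm -/

namespace DetInput

variable {V : Type*} [Fintype V] [DecidableEq V] (P : DetInput V)

theorem marks_zero (B : ℕ → ℕ → Finset V) (t : ℕ) : marks B t 0 = Finset.univ := by
  simp [marks]

theorem marks_setBits_succ (B : ℕ → ℕ → Finset V) (t i : ℕ) (b : Finset V) :
    marks (setBits B t i b) t (i + 1) = marks B t i ∩ b := by
  ext u
  simp only [marks, setBits, Function.update_self, Finset.mem_range, Finset.mem_filter,
    Finset.mem_univ, true_and, Finset.mem_inter]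
  constructor
  · intro h
    refine ⟨fun a ha => ?_, by simpa using h i (by omega)⟩
    have := h a (by omega)
    rwa [Function.update_of_ne (by omega)] at this
  · rintro ⟨h, hb⟩ a ha
    rcases eq_or_ne a i with rfl | hne
    · simpa using hb
    · rw [Function.update_of_ne hne]
      exact h a (by omega)

theorem marks_setBits_of_ne (B : ℕ → ℕ → Finset V) {t u : ℕ} (h : u ≠ t) (i a : ℕ)
    (b : Finset V) : marks (setBits B t i b) u a = marks B u a := by
  simp [marks, setBits, Function.update_of_ne h]

/-- The independent set at time `t`. -/
noncomputable def indep (B : ℕ → ℕ → Finset V) (t : ℕ) : Finset V := (P.state B t).1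

theorem indep_succ (B : ℕ → ℕ → Finset V) (t : ℕ) :
    P.indep B (t + 1) = P.indep B t ∪ stayMarked (P.graph B t) (marks B t P.s) := rfl

theorem graph_succ (B : ℕ → ℕ → Finset V) (t : ℕ) :
    P.graph B (t + 1) = residualGraph P.edges (P.indep B (t + 1)) := rfl

theorem state_setBits (B : ℕ → ℕ → Finset V) (t i : ℕ) (b : Finset V) {u : ℕ} (hu : u ≤ t) :
    P.state (setBits B t i b) u = P.state B u := by
  induction u with
  | zero => rfl
  | succ u ih =>
    rw [state, state, ih (by omega), marks_setBits_of_ne B (by omega)]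

theorem graph_setBits (B : ℕ → ℕ → Finset V) (t i : ℕ) (b : Finset V) {u : ℕ} (hu : u ≤ t) :
    P.graph (setBits B t i b) u = P.graph B u := by
  rw [graph, graph, P.state_setBits B t i b hu]

theorem D_setBits (B : ℕ → ℕ → Finset V) (t i : ℕ) (b : Finset V) {u : ℕ} (hu : u ≤ t) (j : ℕ)
    (X : Finset V) : P.D (setBits B t i b) u j X = P.D B u j X := by
  rw [D, D, P.graph_setBits B t i b hu]

/-- At time 0 the graph is the input itself with an empty independent set. Nested edges are not
removed there, so arguments by minimality of edges apply only from time 1 on. -/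
theorem graph_subset_preResidual (B : ℕ → ℕ → Finset V) (t : ℕ) :
    P.graph B t ⊆ preResidual P.edges (P.indep B t) := by
  intro e he
  cases t with
  | zero => exact mem_preResidual.2 (Or.inr ⟨e, he, by simp [indep, state]⟩)
  | succ t => exact (Finset.mem_filter.1 he).1

theorem exists_edge_of_mem_graph {B : ℕ → ℕ → Finset V} {t : ℕ} {e : Finset V}
    (he : e ∈ P.graph B t) (h2 : 2 ≤ e.card) : ∃ f ∈ P.edges, f \ P.indep B t = e := by
  rcases mem_preResidual.1 (P.graph_subset_preResidual B t he) with ⟨u, _, rfl⟩ | h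
  · simp at h2
  · exact h

theorem exists_mem_graph_subset (B : ℕ → ℕ → Finset V) (t : ℕ) {f : Finset V}
    (hf : f ∈ P.edges) :
    ∃ e ∈ P.graph B t, e ⊆ f \ P.indep B t := by
  cases t with
  | zero => exact ⟨f, hf, by simp [indep, state]⟩
  | succ t => exact exists_mem_residualGraph_subset (mem_preResidual.2 (Or.inr ⟨f, hf, rfl⟩))

theorem two_le_card_union {X Y : Finset V} (hX : X.Nonempty) (hY : 1 ≤ Y.card)
    (h : Disjoint X Y) : 2 ≤ (X ∪ Y).card := by
  rw [Finset.card_union_of_disjoint h]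
  have := hX.card_pos
  omega

theorem exists_edge_superset_of_mem_nbhd {B : ℕ → ℕ → Finset V} {t j : ℕ} {X Y : Finset V}
    (hX : X.Nonempty) (hj : 1 ≤ j) (hY : Y ∈ nbhd (P.graph B t) j X) :
    ∃ f ∈ P.edges, X ∪ Y ⊆ f := by
  obtain ⟨h1, h2, h3⟩ := mem_nbhd.1 hY
  obtain ⟨f, hf, hfe⟩ := P.exists_edge_of_mem_graph h2 (two_le_card_union hX (by omega) h1)
  exact ⟨f, hf, hfe ▸ Finset.sdiff_subset⟩

/-- This is why the potential may restrict its sets to subsets of input edges, which keeps the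
number of summands polynomial in `m`. -/
theorem D_eq_zero_of_not_subset (B : ℕ → ℕ → Finset V) (t : ℕ) {j : ℕ} {X : Finset V}
    (hX : X.Nonempty) (hj : 1 ≤ j) (h : ∀ f ∈ P.edges, ¬ X ⊆ f) : P.D B t j X = 0 := by
  rw [D, hdeg, Finset.card_eq_zero, Finset.eq_empty_iff_forall_notMem]
  intro Y hY
  obtain ⟨f, hf, hfe⟩ := P.exists_edge_superset_of_mem_nbhd hX hj hY
  exact h f hf (Finset.subset_union_left.trans hfe)

theorem D_eq_zero_of_rank_lt (hr : ∀ e ∈ P.edges, e.card ≤ P.r) (B : ℕ → ℕ → Finset V) (t : ℕ)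
    {j : ℕ} {X : Finset V} (hX : X.Nonempty) (hj : 1 ≤ j) (h : P.r < X.card + j) :
    P.D B t j X = 0 := by
  rw [D, hdeg, Finset.card_eq_zero, Finset.eq_empty_iff_forall_notMem]
  intro Y hY
  obtain ⟨f, hf, hfe⟩ := P.exists_edge_superset_of_mem_nbhd hX hj hY
  have h1 := Finset.card_le_card hfe
  obtain ⟨h2, _, h3⟩ := mem_nbhd.1 hY
  rw [Finset.card_union_of_disjoint h2] at h1
  have := hr f hf
  omega

theorem H_nonneg (B : ℕ → ℕ → Finset V) (t j q : ℕ) (X : Finset V) (i : ℕ) (Y : Finset V) :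
    0 ≤ P.H B t j q X i Y :=
  Finset.sum_nonneg fun _ _ => Nat.cast_nonneg _

theorem H_eq_zero_of_not_subset (B : ℕ → ℕ → Finset V) (t : ℕ) {j : ℕ} (hj : 1 ≤ j) (q : ℕ)
    {X : Finset V} (hX : X.Nonempty) (i : ℕ) {Y : Finset V} (h : ∀ f ∈ P.edges, ¬ Y ⊆ f) :
    P.H B t j q X i Y = 0 := by
  refine Finset.sum_eq_zero fun Z hZ => ?_
  rw [Finset.mem_filter] at hZ
  rw [P.D_eq_zero_of_not_subset B t (hX.mono Finset.subset_union_left) hj, Nat.cast_zero]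
  intro f hf hZf
  exact h f hf (hZ.2.2.1.trans (Finset.subset_union_right.trans hZf))

/-- One round increases `D_j(X)` at most by the number of edges `X ∪ Z ∪ Y` with `|Y| = j` and `Z`
nonempty and marked. -/
theorem D_succ_le (hr : ∀ e ∈ P.edges, e.card ≤ P.r) (B : ℕ → ℕ → Finset V) (t : ℕ) {j : ℕ}
    {X : Finset V} (hX : X.Nonempty) (hj : 1 ≤ j) :
    (P.D B (t + 1) j X : ℝ) ≤
      P.D B t j X + ∑ k ∈ Finset.Ioc j P.r, P.H B t j (k - j) X P.s ∅ := by
  classical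
  set F : ℕ → Finset (Finset V) := fun k => Finset.univ.filter fun Z =>
    Disjoint X Z ∧ ∅ ⊆ Z ∧ Z.card = k - j ∧ Z ⊆ marks B t P.s with hF
  have hsub : nbhd (P.graph B (t + 1)) j X ⊆ nbhd (P.graph B t) j X ∪
      (Finset.Ioc j P.r).biUnion fun k => (F k).biUnion fun Z =>
        nbhd (P.graph B t) j (X ∪ Z) := by
    intro Y hY
    obtain ⟨hXY, hE, hYj⟩ := mem_nbhd.1 hY
    have h2 := two_le_card_union hX (by omega) hXY
    obtain ⟨f, hf, hfe⟩ := P.exists_edge_of_mem_graph hE h2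
    -- `X ∪ Y` is `f` minus the new independent set, and `e` is an old edge inside `f` minus the old
    -- one. Removing the newly added vertices `A` from `e` leaves a subset of `X ∪ Y`, hence by
    -- minimality all of it; the removed part is `Z`.
    obtain ⟨e, he, hef⟩ := P.exists_mem_graph_subset B t hf
    set A := stayMarked (P.graph B t) (marks B t P.s) with hA
    have hIA : P.indep B (t + 1) = P.indep B t ∪ A := P.indep_succ B t
    have heA : e \ A ⊆ X ∪ Y := by
      rw [← hfe, hIA]
      intro u hu
      rw [Finset.mem_sdiff] at hu
      have := Finset.mem_sdiff.1 (hef hu.1)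
      rw [Finset.mem_sdiff, Finset.mem_union, not_or]
      exact ⟨this.1, this.2, hu.2⟩
    have hpre : e \ A ∈ preResidual P.edges (P.indep B (t + 1)) := by
      rcases mem_preResidual.1 (P.graph_subset_preResidual B t he) with ⟨u, hu, rfl⟩ | ⟨f', hf', h⟩
      · exact absurd hu (Finset.mem_sdiff.1 (hef (Finset.mem_singleton_self u))).2
      · refine mem_preResidual.2 (Or.inr ⟨f', hf', ?_⟩)
        rw [hIA, ← h]
        ext u
        simp only [Finset.mem_sdiff, Finset.mem_union]
        tauto
    have heq : e \ A = X ∪ Y := by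
      rw [P.graph_succ] at hE
      exact eq_of_subset_of_mem_residualGraph hpre hE heA
    set Z := e ∩ A with hZ
    have heZ : e = (X ∪ Z) ∪ Y := by
      have h : e \ A ∪ e ∩ A = e := Finset.sdiff_union_inter e A
      rw [heq] at h
      rw [← h, Finset.union_right_comm]
    have hdisj : Disjoint (X ∪ Y) Z := by
      rw [← heq]
      exact Finset.disjoint_of_subset_right Finset.inter_subset_right Finset.sdiff_disjoint
    rw [Finset.disjoint_union_left] at hdisj
    rcases Z.eq_empty_or_nonempty with h0 | h0
    · refine Finset.mem_union_left _ (mem_nbhd.2 ⟨hXY, ?_, hYj⟩)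
      rw [h0, Finset.union_empty] at heZ
      rwa [← heZ]
    · refine Finset.mem_union_right _ ?_
      simp only [Finset.mem_biUnion, hF, Finset.mem_filter, Finset.mem_univ, true_and,
        Finset.mem_Ioc, Finset.empty_subset]
      have hY' : Y ∈ nbhd (P.graph B t) j (X ∪ Z) :=
        mem_nbhd.2 ⟨Finset.disjoint_union_left.2 ⟨hXY, hdisj.2.symm⟩, heZ ▸ he, hYj⟩
      have hcard : j + Z.card ≤ P.r := by
        by_contra hlt
        have hX0 := hX.card_pos
        have := P.D_eq_zero_of_rank_lt hr B t (j := j) (hX.mono (Finset.subset_union_left (s₂ := Z)))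
          hj (by rw [Finset.card_union_of_disjoint hdisj.1]; omega)
        rw [D, hdeg, Finset.card_eq_zero] at this
        simp [this] at hY'
      refine ⟨j + Z.card, ⟨?_, hcard⟩, Z, ⟨hdisj.1, by omega, ?_⟩, hY'⟩
      · have := h0.card_pos
        omega
      · exact Finset.inter_subset_right.trans (stayMarked_subset _ _)
  have hcard : P.D B (t + 1) j X ≤ P.D B t j X +
      ∑ k ∈ Finset.Ioc j P.r, ∑ Z ∈ F k, P.D B t j (X ∪ Z) := by
    refine (Finset.card_le_card hsub).trans ((Finset.card_union_le _ _).trans ?_)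
    refine Nat.add_le_add_left (Finset.card_biUnion_le.trans ?_) _
    exact Finset.sum_le_sum fun k _ => Finset.card_biUnion_le
  calc (P.D B (t + 1) j X : ℝ) ≤ ((P.D B t j X +
      ∑ k ∈ Finset.Ioc j P.r, ∑ Z ∈ F k, P.D B t j (X ∪ Z) : ℕ) : ℝ) := Nat.cast_le.2 hcard
    _ = _ := by push_cast; rfl

/-- A term exceeds 0 only if its `Y` is the sole fully marked neighbour: any other marked `Y'`
contributes a full 1 to the subtracted sum. So at most one term counts, with value at most 1. This
keeps `phi` nonnegative. -/
theorem collapseEst_le_one (G : Finset (Finset V)) (k : ℕ) (X C : Finset V) :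
    collapseEst G k X C ≤ 1 := by
  have key : ∀ Y ∈ nbhd G k X, (if Y ⊆ C then (1 : ℝ) else 0) *
      (1 - (∑ e ∈ G with (e ∩ Y).Nonempty, if e \ Y ⊆ C then (1 : ℝ) else 0)
       - ∑ Y' ∈ (nbhd G k X).erase Y, if Y' \ Y ⊆ C then (1 : ℝ) else 0) ≤
      if (Y ⊆ C ∧ ∀ Y' ∈ (nbhd G k X).erase Y, ¬ Y' ⊆ C) then 1 else 0 := by
    intro Y hY
    have hs1 : 0 ≤ ∑ e ∈ G with (e ∩ Y).Nonempty, if e \ Y ⊆ C then (1 : ℝ) else 0 :=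
      Finset.sum_nonneg fun _ _ => by split_ifs <;> norm_num
    have hs2 : ∀ Y' ∈ (nbhd G k X).erase Y, (0 : ℝ) ≤ if Y' \ Y ⊆ C then (1 : ℝ) else 0 :=
      fun _ _ => by split_ifs <;> norm_num
    by_cases hYC : Y ⊆ C
    · by_cases hall : ∀ Y' ∈ (nbhd G k X).erase Y, ¬ Y' ⊆ C
      · rw [if_pos hYC, if_pos ⟨hYC, hall⟩]
        have := Finset.sum_nonneg hs2
        linarith
      · rw [if_pos hYC, if_neg (fun h => hall h.2)]
        push Not at hall
        obtain ⟨Y', hY', hC⟩ := hall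
        have := Finset.single_le_sum hs2 hY'
        rw [if_pos (Finset.sdiff_subset.trans hC)] at this
        linarith
    · rw [if_neg hYC, if_neg (fun h => hYC h.1), zero_mul]
  refine (Finset.sum_le_sum key).trans ?_
  rw [Finset.sum_boole]
  norm_cast
  rw [Finset.card_le_one]
  intro a ha b hb
  rw [Finset.mem_filter] at ha hb
  by_contra hne
  exact ha.2.2 b (Finset.mem_erase.2 ⟨fun h => hne h.symm, hb.1⟩) hb.2.1

/-- If the estimator is positive then `X` collapses. -/
theorem D_succ_eq_zero_of_collapseEst_pos {B : ℕ → ℕ → Finset V} {t k : ℕ} {X : Finset V}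
    (hX : X.Nonempty) (hk : 1 ≤ k)
    (h : 0 < collapseEst (P.graph B t) k X (marks B t P.s)) : P.D B (t + 1) k X = 0 := by
  set C := marks B t P.s with hC
  have h' : ∑ _Y ∈ nbhd (P.graph B t) k X, (0 : ℝ) < collapseEst (P.graph B t) k X C := by
    rwa [Finset.sum_const_zero]
  rw [collapseEst] at h'
  -- A positive term means that `Y` is marked and no edge meeting `Y` is fully marked, so that no
  -- vertex of `Y` is unmarked again.
  obtain ⟨Y, hY, hpos⟩ := Finset.exists_lt_of_sum_lt h'
  have hs2 : 0 ≤ ∑ Y' ∈ (nbhd (P.graph B t) k X).erase Y, if Y' \ Y ⊆ C then (1 : ℝ) else 0 :=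
    Finset.sum_nonneg fun _ _ => by split_ifs <;> norm_num
  have hYC : Y ⊆ C := by
    by_contra hYC
    simp [hYC] at hpos
  have hedge : ∀ e ∈ P.graph B t, (e ∩ Y).Nonempty → ¬ e \ Y ⊆ C := by
    intro e he heY heC
    have := Finset.single_le_sum (s := (P.graph B t).filter fun e => (e ∩ Y).Nonempty)
      (f := fun e => if e \ Y ⊆ C then (1 : ℝ) else 0)
      (fun _ _ => by positivity) (Finset.mem_filter.2 ⟨he, heY⟩)
    simp only [heC, if_true] at this
    rw [if_pos hYC] at hpos
    linarith
  have hstay : Y ⊆ stayMarked (P.graph B t) C := by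
    intro u hu
    refine Finset.mem_filter.2 ⟨hYC hu, fun e he hue heC => ?_⟩
    exact hedge e he ⟨u, Finset.mem_inter.2 ⟨hue, hu⟩⟩ (Finset.sdiff_subset.trans heC)
  obtain ⟨hXY, hE, hYk⟩ := mem_nbhd.1 hY
  obtain ⟨f, hf, hfe⟩ := P.exists_edge_of_mem_graph hE (two_le_card_union hX (by omega) hXY)
  -- The edge through `X ∪ Y` shrinks into `X`. By minimality an edge `X ∪ Y'` would have to equal
  -- this trace, which forces `Y'` to be empty.
  have hfX : f \ P.indep B (t + 1) ⊆ X := by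
    intro u hu
    rw [P.indep_succ, Finset.mem_sdiff, Finset.mem_union, not_or] at hu
    have : u ∈ X ∪ Y := hfe ▸ Finset.mem_sdiff.2 ⟨hu.1, hu.2.1⟩
    rcases Finset.mem_union.1 this with h | h
    · exact h
    · exact absurd (hstay h) hu.2.2
  rw [D, hdeg, Finset.card_eq_zero, Finset.eq_empty_iff_forall_notMem]
  intro Y' hY'
  obtain ⟨hXY', hE', hY'k⟩ := mem_nbhd.1 hY'
  rw [P.graph_succ] at hE'
  have := eq_of_subset_of_mem_residualGraph (mem_preResidual.2 (Or.inr ⟨f, hf, rfl⟩)) hE'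
    (hfX.trans Finset.subset_union_left)
  rw [this] at hfX
  have hsub : Y' ⊆ X := Finset.subset_union_right.trans hfX
  have hemp : Y' = ∅ := by
    rw [← Finset.subset_empty]
    intro u hu
    exact absurd hu (Finset.disjoint_left.1 hXY' (hsub hu))
  rw [hemp, Finset.card_empty] at hY'k
  omega

end DetInput

/-! ### Moments and expectations over the bit-vectors -/

section Space

variable {V : Type*} [Fintype V] [DecidableEq V]

theorem sum_toReal_eq_one (Ω : PMF (Finset V)) : ∑ b, (Ω b).toReal = 1 := by
  rw [← ENNReal.toReal_sum (fun b _ => Ω.apply_ne_top b),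
    ← tsum_fintype (L := .unconditional _), Ω.tsum_coe, ENNReal.toReal_one]

theorem bitProb_eq_sum (Ω : PMF (Finset V)) (A : Finset V → Prop) [DecidablePred A] :
    bitProb Ω A = ∑ b, (Ω b).toReal * (if A b then 1 else 0) := by
  simp [bitProb, Finset.sum_filter]

theorem ApproxIndep.bitProb_subset_le {Ω : PMF (Finset V)} {L : ℝ} (h : ApproxIndep Ω L)
    {S : Finset V} (hS : (S.card : ℝ) ≤ L) :
    ∑ b, (Ω b).toReal * (if S ⊆ b then 1 else 0) ≤ 2 * (1 / 2) ^ S.card := by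
  have := h S S le_rfl hS
  rw [bitProb_eq_sum] at this
  simpa only [Finset.inter_eq_right] using this

/-- A bound on moments of positive sums of monomials in approximately independent bits. -/
theorem ApproxIndep.moment_le {Ω : PMF (Finset V)} {L : ℝ} (h : ApproxIndep Ω L) {ι : Type*}
    (s : Finset ι) {a : ι → ℝ} (ha : ∀ z ∈ s, 0 ≤ a z) (S : ι → Finset V) {d : ℕ}
    (hS : ∀ z ∈ s, (S z).card ≤ d) {β M : ℝ} (hβ : 0 ≤ β) (hM0 : 0 ≤ M)
    (hM : ∀ U : Finset V, (U.card : ℝ) ≤ L → ∑ z ∈ s, a z * (1 / 2) ^ (S z \ U).card ≤ M)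
    (w : ℕ) (U : Finset V) (hU : (U.card : ℝ) + w * d ≤ L) :
    ∑ b, (Ω b).toReal * ((β + ∑ z ∈ s, a z * (if S z ⊆ b then 1 else 0)) ^ w *
      (if U ⊆ b then 1 else 0)) ≤ 2 * (1 / 2) ^ U.card * (β + M) ^ w := by
  -- `U` collects the positions already required to be one. Expanding one factor either picks `β` or
  -- replaces `U` by `U ∪ S z`, at the price `(1 / 2) ^ (S z \ U).card`. The factor 2 of approximate
  -- independence is paid only once, at `w = 0`.
  induction w generalizing U with
  | zero => simpa using h.bitProb_subset_le (S := U) (by simpa using hU)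
  | succ w ih =>
    have hstep : ∀ b : Finset V, (Ω b).toReal *
        ((β + ∑ z ∈ s, a z * (if S z ⊆ b then 1 else 0)) ^ (w + 1) * (if U ⊆ b then 1 else 0)) =
        β * ((Ω b).toReal * ((β + ∑ z ∈ s, a z * (if S z ⊆ b then 1 else 0)) ^ w *
          (if U ⊆ b then 1 else 0))) +
        ∑ z ∈ s, a z * ((Ω b).toReal * ((β + ∑ z ∈ s, a z * (if S z ⊆ b then 1 else 0)) ^ w *
          (if U ∪ S z ⊆ b then 1 else 0))) := by
      intro b
      set R := (β + ∑ z ∈ s, a z * (if S z ⊆ b then (1 : ℝ) else 0)) ^ w with hR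
      have : ∑ z ∈ s, a z * ((Ω b).toReal * (R * (if U ∪ S z ⊆ b then 1 else 0))) =
          (Ω b).toReal * (R * (if U ⊆ b then 1 else 0)) *
            ∑ z ∈ s, a z * (if S z ⊆ b then (1 : ℝ) else 0) := by
        rw [Finset.mul_sum]
        refine Finset.sum_congr rfl fun z _ => ?_
        by_cases h1 : U ⊆ b <;> by_cases h2 : S z ⊆ b <;>
          simp [Finset.union_subset_iff, h1, h2]
        ring
      rw [this, pow_succ, ← hR]
      ring
    rw [Finset.sum_congr rfl fun b _ => hstep b, Finset.sum_add_distrib, ← Finset.mul_sum,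
      Finset.sum_comm]
    simp_rw [← Finset.mul_sum]
    push_cast at hU
    have hd0 : (0 : ℝ) ≤ d := Nat.cast_nonneg d
    have hw0 : (0 : ℝ) ≤ w * d := by positivity
    have h1 := ih U (by nlinarith)
    have h2 : ∀ z ∈ s, a z * ∑ b, (Ω b).toReal *
        ((β + ∑ z ∈ s, a z * (if S z ⊆ b then 1 else 0)) ^ w *
          (if U ∪ S z ⊆ b then 1 else 0)) ≤
        a z * (1 / 2) ^ (S z \ U).card * (2 * (1 / 2) ^ U.card * (β + M) ^ w) := by
      intro z hz
      have hcard : (U ∪ S z).card = U.card + (S z \ U).card := by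
        rw [← Finset.union_sdiff_self_eq_union,
          Finset.card_union_of_disjoint Finset.disjoint_sdiff]
      have hle : ((S z \ U).card : ℝ) ≤ d :=
        Nat.cast_le.2 ((Finset.card_le_card Finset.sdiff_subset).trans (hS z hz))
      have := ih (U ∪ S z) (by rw [hcard]; push_cast; linarith)
      rw [hcard, pow_add] at this
      calc _ ≤ a z * _ := mul_le_mul_of_nonneg_left this (ha z hz)
        _ = _ := by ring
    have h3 := Finset.sum_le_sum h2
    rw [← Finset.sum_mul] at h3
    have hK : 0 ≤ 2 * (1 / 2) ^ U.card * (β + M) ^ w := by positivity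
    have h4 := mul_le_mul_of_nonneg_right (hM U (by nlinarith)) hK
    have h5 := mul_le_mul_of_nonneg_left h1 hβ
    calc _ ≤ β * (2 * (1 / 2) ^ U.card * (β + M) ^ w) +
        M * (2 * (1 / 2) ^ U.card * (β + M) ^ w) := add_le_add h5 (h3.trans h4)
      _ = _ := by rw [pow_succ]; ring

theorem expectMarks_sub (Ω : PMF (Finset V)) (f f' : Finset V → ℝ) (a : ℕ) (C : Finset V) :
    expectMarks Ω (fun C => f C - f' C) a C = expectMarks Ω f a C - expectMarks Ω f' a C := by
  induction a generalizing C with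
  | zero => rfl
  | succ a ih =>
    simp only [expectMarks, ih, mul_sub, Finset.sum_sub_distrib]

theorem expectMarks_sum (Ω : PMF (Finset V)) {ι : Type*} (s : Finset ι) (f : ι → Finset V → ℝ)
    (a : ℕ) (C : Finset V) :
    expectMarks Ω (fun C => ∑ i ∈ s, f i C) a C = ∑ i ∈ s, expectMarks Ω (f i) a C := by
  induction a generalizing C with
  | zero => rfl
  | succ a ih =>
    simp only [expectMarks, ih, Finset.mul_sum]
    rw [Finset.sum_comm]

theorem expectMarks_subset (Ω : PMF (Finset V)) (S : Finset V) (a : ℕ) (C : Finset V) :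
    expectMarks Ω (fun C => if S ⊆ C then 1 else 0) a C =
      (if S ⊆ C then 1 else 0) * bitProb Ω (fun b => S ⊆ b) ^ a := by
  induction a generalizing C with
  | zero => simp [expectMarks]
  | succ a ih =>
    simp only [expectMarks, ih, Finset.subset_inter_iff]
    rw [pow_succ, ← mul_assoc, bitProb_eq_sum, Finset.mul_sum]
    refine Finset.sum_congr rfl fun b _ => ?_
    by_cases h1 : S ⊆ C <;> by_cases h2 : S ⊆ b <;> simp [h1, h2, mul_comm]

theorem expectMarks_le_one (Ω : PMF (Finset V)) {f : Finset V → ℝ} (hf : ∀ C, f C ≤ 1) (a : ℕ)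
    (C : Finset V) : expectMarks Ω f a C ≤ 1 := by
  induction a generalizing C with
  | zero => exact hf C
  | succ a ih =>
    rw [expectMarks, ← sum_toReal_eq_one Ω]
    exact Finset.sum_le_sum fun b _ => mul_le_of_le_one_right ENNReal.toReal_nonneg (ih _)

end Space

/-! ### The probability that a set collapses -/

namespace DetInput

variable {V : Type*} [Fintype V] [DecidableEq V] (P : DetInput V)

theorem expCollapse_le_one (B : ℕ → ℕ → Finset V) (l i k : ℕ) (X : Finset V) :
    P.expCollapse B l i k X ≤ 1 :=
  expectMarks_le_one _ (fun C => collapseEst_le_one _ _ _ C) _ _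

/-- In this form the estimator is a signed sum of events that a fixed set is marked, whose
probabilities are exact by `EdgeIndep`. -/
theorem collapseEst_eq (G : Finset (Finset V)) (k : ℕ) (X C : Finset V) :
    collapseEst G k X C = ∑ Y ∈ nbhd G k X, ((if Y ⊆ C then 1 else 0) -
      (∑ e ∈ G with (e ∩ Y).Nonempty, if Y ∪ (e \ Y) ⊆ C then 1 else 0) -
      ∑ Y' ∈ (nbhd G k X).erase Y, if Y ∪ (Y' \ Y) ⊆ C then 1 else 0) := by
  refine Finset.sum_congr rfl fun Y _ => ?_
  simp only [Finset.union_subset_iff]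
  by_cases h : Y ⊆ C <;> simp [h]

theorem expectMarks_subset_univ {s : ℕ} {Ω : PMF (Finset V)} {S : Finset V}
    (h : bitProb Ω (fun b => S ⊆ b) = (1 / 2) ^ S.card) :
    expectMarks Ω (fun C => if S ⊆ C then 1 else 0) s Finset.univ = ((1 / 2) ^ s) ^ S.card := by
  rw [expectMarks_subset, h, if_pos (Finset.subset_univ S), one_mul, ← pow_mul, ← pow_mul,
    mul_comm]

theorem card_union_sdiff (Y e : Finset V) : (Y ∪ (e \ Y)).card = Y.card + (e \ Y).card :=
  Finset.card_union_of_disjoint Finset.disjoint_sdiff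

/-- The edges that meet `Y` without being contained in it, weighted by `z` per vertex outside. -/
theorem sum_edges_meeting_le (G : Finset (Finset V)) {r : ℕ} {z δ : ℝ} (hz : 0 ≤ z)
    (Y : Finset V) (hne : ∀ e ∈ G, (e ∩ Y).Nonempty → 1 ≤ (e \ Y).card ∧ (e \ Y).card ≤ r)
    (hD : ∀ X : Finset V, X.Nonempty → ∀ j, 1 ≤ j → (hdeg G j X : ℝ) * z ^ j ≤ δ) (hδ : 0 ≤ δ) :
    ∑ e ∈ G with (e ∩ Y).Nonempty, z ^ (e \ Y).card ≤ 2 ^ Y.card * (r * δ) := by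
  have h1 : ∑ e ∈ G with (e ∩ Y).Nonempty, z ^ (e \ Y).card ≤
      ∑ p ∈ (Y.powerset.filter (·.Nonempty)).sigma fun X' =>
        (Finset.Icc 1 r).sigma fun j => nbhd G j X', z ^ p.2.1 := by
    -- An edge `e` meeting `Y` is a neighbour `e \ Y` of the nonempty set `e ∩ Y`, so the sum is
    -- organized by the at most `2 ^ Y.card` traces on `Y`.
    refine Finset.sum_le_sum_of_injOn_maps
      (fun e => (⟨e ∩ Y, ⟨(e \ Y).card, e \ Y⟩⟩ : (_ : Finset V) × (_ : ℕ) × Finset V)) ?_ ?_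
      (fun _ _ => le_rfl) (fun _ _ => by positivity)
    · intro e he
      rw [Finset.mem_filter] at he
      simp only [Finset.mem_sigma, Finset.mem_filter, Finset.mem_powerset, Finset.mem_Icc,
        mem_nbhd]
      refine ⟨⟨Finset.inter_subset_right, he.2⟩, hne e he.1 he.2, ?_, ?_, trivial⟩
      · exact Finset.disjoint_of_subset_left Finset.inter_subset_right Finset.disjoint_sdiff
      · rw [Finset.union_comm, Finset.sdiff_union_inter]
        exact he.1
    · intro e _ e' _ h
      simp only [Sigma.mk.injEq] at h
      have h2 : e \ Y = e' \ Y := by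
        have := h.2
        rw [heq_eq_eq] at this
        simp only [Sigma.mk.injEq, heq_eq_eq] at this
        exact this.2
      rw [← Finset.sdiff_union_inter e Y, ← Finset.sdiff_union_inter e' Y, h.1, h2]
  refine h1.trans ?_
  rw [Finset.sum_sigma]
  simp_rw [Finset.sum_sigma]
  have h2 : ∀ X' ∈ Y.powerset.filter (·.Nonempty),
      ∑ j ∈ Finset.Icc 1 r, ∑ _W ∈ nbhd G j X', z ^ j ≤ r * δ := by
    intro X' hX'
    rw [Finset.mem_filter] at hX'
    calc ∑ j ∈ Finset.Icc 1 r, ∑ _W ∈ nbhd G j X', z ^ j ≤ ∑ j ∈ Finset.Icc 1 r, δ := by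
          refine Finset.sum_le_sum fun j hj => ?_
          rw [Finset.sum_const, nsmul_eq_mul]
          exact hD X' hX'.2 j (Finset.mem_Icc.1 hj).1
      _ = r * δ := by simp
  refine (Finset.sum_le_sum h2).trans ?_
  rw [Finset.sum_const, nsmul_eq_mul]
  refine mul_le_mul_of_nonneg_right ?_ (by positivity)
  calc ((Y.powerset.filter (·.Nonempty)).card : ℝ) ≤ (Y.powerset.card : ℝ) :=
        Nat.cast_le.2 (Finset.card_filter_le _ _)
    _ = 2 ^ Y.card := by simp

/-- The other `k`-neighbours of `X`, weighted by `z` per vertex outside `Y`. -/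
theorem sum_nbhd_erase_le (G : Finset (Finset V)) {k : ℕ} {z δ : ℝ} (hz : 0 ≤ z)
    {X Y : Finset V} (hX : X.Nonempty) (hY : Y ∈ nbhd G k X)
    (hD : ∀ X : Finset V, X.Nonempty → ∀ j, 1 ≤ j → (hdeg G j X : ℝ) * z ^ j ≤ δ) (hδ : 0 ≤ δ) :
    ∑ Y' ∈ (nbhd G k X).erase Y, z ^ (Y' \ Y).card ≤ 2 ^ k * δ := by
  have hYk := (mem_nbhd.1 hY).2.2
  have h1 : ∑ Y' ∈ (nbhd G k X).erase Y, z ^ (Y' \ Y).card ≤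
      ∑ p ∈ (Y.powerset.filter (·.card < k)).sigma fun U =>
        nbhd G (k - U.card) (X ∪ U), z ^ (k - p.1.card) := by
    -- `Y'` is organized by its trace `U` on `Y`. As `Y'` and `Y` are distinct of equal size, `U`
    -- has fewer than `k` elements and `Y' \ Y` is a nonempty neighbour of `X ∪ U`.
    refine Finset.sum_le_sum_of_injOn_maps
      (fun Y' => (⟨Y' ∩ Y, Y' \ Y⟩ : (_ : Finset V) × Finset V)) ?_ ?_ ?_
      (fun _ _ => by positivity)
    · intro Y' hY'
      obtain ⟨hne, hY'⟩ := Finset.mem_erase.1 hY'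
      obtain ⟨hd, hE, hk⟩ := mem_nbhd.1 hY'
      have hc := Finset.card_sdiff_add_card_inter Y' Y
      have hpos : 0 < (Y' \ Y).card := by
        rw [Finset.card_pos, Finset.sdiff_nonempty]
        intro hsub
        exact hne (Finset.eq_of_subset_of_card_le hsub (by omega))
      simp only [Finset.mem_sigma, Finset.mem_filter, Finset.mem_powerset, mem_nbhd]
      refine ⟨⟨Finset.inter_subset_right, by omega⟩, ?_, ?_, by omega⟩
      · rw [Finset.disjoint_union_left]
        exact ⟨hd.mono_right Finset.sdiff_subset,
          Finset.disjoint_of_subset_left Finset.inter_subset_right Finset.disjoint_sdiff⟩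
      · rw [Finset.union_assoc, Finset.union_comm (Y' ∩ Y), Finset.sdiff_union_inter]
        exact hE
    · intro e _ e' _ h
      simp only [Sigma.mk.injEq, heq_eq_eq] at h
      rw [← Finset.sdiff_union_inter e Y, ← Finset.sdiff_union_inter e' Y, h.1, h.2]
    · intro Y' hY'
      have hk := (mem_nbhd.1 (Finset.mem_erase.1 hY').2).2.2
      have hc := Finset.card_sdiff_add_card_inter Y' Y
      have : k - (Y' ∩ Y).card = (Y' \ Y).card := by omega
      simp only [this, le_refl]
  refine h1.trans ?_
  rw [Finset.sum_sigma]
  have h2 : ∀ U ∈ Y.powerset.filter (·.card < k),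
      ∑ _W ∈ nbhd G (k - U.card) (X ∪ U), z ^ (k - U.card) ≤ δ := by
    intro U hU
    rw [Finset.mem_filter] at hU
    rw [Finset.sum_const, nsmul_eq_mul]
    exact hD (X ∪ U) (hX.mono Finset.subset_union_left) _ (by omega)
  refine (Finset.sum_le_sum h2).trans ?_
  rw [Finset.sum_const, nsmul_eq_mul]
  refine mul_le_mul_of_nonneg_right ?_ hδ
  calc ((Y.powerset.filter (·.card < k)).card : ℝ) ≤ (Y.powerset.card : ℝ) :=
        Nat.cast_le.2 (Finset.card_filter_le _ _)
    _ = 2 ^ k := by simp [hYk]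

/-- After the first round, a set `X` of large degree collapses with good probability. -/
theorem le_expCollapse (hr : ∀ e ∈ P.edges, e.card ≤ P.r) (hind : EdgeIndep P.Ω P.edges)
    (B : ℕ → ℕ → Finset V) (t k : ℕ) (hk : 1 ≤ k) {X : Finset V} (hX : X.Nonempty) {δ : ℝ}
    (hδ : 0 ≤ δ)
    (hD : ∀ X : Finset V, X.Nonempty → ∀ j, 1 ≤ j →
      (P.D B (t + 1) j X : ℝ) * ((1 / 2) ^ P.s) ^ j ≤ δ)
    (hsmall : 2 ^ k * (P.r * δ) + 2 ^ k * δ ≤ 1 / 2) :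
    P.D B (t + 1) k X * ((1 / 2) ^ P.s) ^ k / 2 ≤ P.expCollapse B (t + 1) 0 k X := by
  set G := P.graph B (t + 1) with hG
  set z : ℝ := (1 / 2) ^ P.s with hz
  have hz0 : 0 ≤ z := by positivity
  have hterm : ∀ Y ∈ nbhd G k X, z ^ k / 2 ≤
      expectMarks P.Ω (fun C => (if Y ⊆ C then (1 : ℝ) else 0) -
      (∑ e ∈ G with (e ∩ Y).Nonempty, if Y ∪ (e \ Y) ⊆ C then (1 : ℝ) else 0) -
      ∑ Y' ∈ (nbhd G k X).erase Y, if Y ∪ (Y' \ Y) ⊆ C then (1 : ℝ) else 0) P.s Finset.univ := by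
    intro Y hY
    obtain ⟨hXY, hE, hYk⟩ := mem_nbhd.1 hY
    obtain ⟨f, hf, hfe⟩ := P.exists_edge_of_mem_graph hE (two_le_card_union hX (by omega) hXY)
    have hYf : Y ⊆ f := Finset.subset_union_right.trans (hfe ▸ Finset.sdiff_subset)
    -- `Y` avoids the independent set, so an edge meeting it is not one of the added singletons but
    -- the trace of an input edge. Thus all events below concern subsets of a union of two input
    -- edges.
    have hmeet : ∀ e ∈ G, (e ∩ Y).Nonempty → ∃ f' ∈ P.edges, f' \ P.indep B (t + 1) = e := by
      rintro e he ⟨u, hu⟩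
      rw [Finset.mem_inter] at hu
      rcases mem_preResidual.1 (P.graph_subset_preResidual B _ he) with ⟨u', hu', rfl⟩ | h
      · have h1 : u ∈ X ∪ Y := Finset.mem_union_right _ hu.2
        rw [← hfe, Finset.mem_sdiff] at h1
        rw [Finset.mem_singleton] at hu
        exact absurd (hu.1 ▸ hu') h1.2
      · exact h
    rw [expectMarks_sub, expectMarks_sub, expectMarks_sum, expectMarks_sum,
      expectMarks_subset_univ (hind f hf f hf Y (hYf.trans Finset.subset_union_left)), hYk]
    have he : ∀ e ∈ G.filter (fun e => (e ∩ Y).Nonempty),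
        expectMarks P.Ω (fun C => if Y ∪ (e \ Y) ⊆ C then (1 : ℝ) else 0) P.s Finset.univ =
          z ^ k * z ^ (e \ Y).card := by
      intro e he
      rw [Finset.mem_filter] at he
      obtain ⟨f', hf', hfe'⟩ := hmeet e he.1 he.2
      rw [expectMarks_subset_univ (hind f hf f' hf' _ (Finset.union_subset_union hYf
        (Finset.sdiff_subset.trans (hfe' ▸ Finset.sdiff_subset)))), card_union_sdiff, hYk, pow_add]
    have hY' : ∀ Y' ∈ (nbhd G k X).erase Y,
        expectMarks P.Ω (fun C => if Y ∪ (Y' \ Y) ⊆ C then (1 : ℝ) else 0) P.s Finset.univ =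
          z ^ k * z ^ (Y' \ Y).card := by
      intro Y' hY'
      obtain ⟨f', hf', hfe'⟩ := P.exists_edge_superset_of_mem_nbhd hX hk (Finset.mem_erase.1 hY').2
      rw [expectMarks_subset_univ (hind f hf f' hf' _ (Finset.union_subset_union hYf
        (Finset.sdiff_subset.trans (Finset.subset_union_right.trans hfe')))),
        card_union_sdiff, hYk, pow_add]
    rw [Finset.sum_congr rfl he, Finset.sum_congr rfl hY', ← Finset.mul_sum, ← Finset.mul_sum]
    have b1 := sum_edges_meeting_le G (r := P.r) hz0 Y (fun e he heY => by
      obtain ⟨f', hf', hfe'⟩ := hmeet e he heY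
      constructor
      -- An edge inside `Y` would be nested in the edge `X ∪ Y`. This is excluded only in a residual
      -- graph, hence the time `t + 1`.
      · rw [Nat.one_le_iff_ne_zero, Ne, Finset.card_eq_zero, Finset.sdiff_eq_empty_iff_subset]
        intro hsub
        have := eq_of_subset_of_mem_residualGraph (P.graph_subset_preResidual B _ he) hE
          (hsub.trans Finset.subset_union_right)
        rw [this] at hsub
        obtain ⟨x, hx⟩ := hX
        exact Finset.disjoint_left.1 hXY hx (hsub (Finset.mem_union_left _ hx))
      · refine (Finset.card_le_card ?_).trans (hr f' hf')
        exact Finset.sdiff_subset.trans (hfe' ▸ Finset.sdiff_subset)) hD hδ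
    have b2 := sum_nbhd_erase_le G hz0 hX hY hD hδ
    rw [hYk] at b1
    have hzk : 0 ≤ z ^ k := by positivity
    -- The two error sums are at most `1 / 2` together, so half of the main term `z ^ k` survives.
    nlinarith
  have hexp : P.expCollapse B (t + 1) 0 k X = ∑ Y ∈ nbhd G k X,
      expectMarks P.Ω (fun C => (if Y ⊆ C then (1 : ℝ) else 0) -
      (∑ e ∈ G with (e ∩ Y).Nonempty, if Y ∪ (e \ Y) ⊆ C then (1 : ℝ) else 0) -
      ∑ Y' ∈ (nbhd G k X).erase Y, if Y ∪ (Y' \ Y) ⊆ C then (1 : ℝ) else 0) P.s Finset.univ := by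
    rw [expCollapse, marks_zero, Nat.sub_zero, ← expectMarks_sum]
    congr 1
    funext C
    exact collapseEst_eq _ _ _ _
  rw [hexp]
  calc (P.D B (t + 1) k X : ℝ) * z ^ k / 2 = ∑ _Y ∈ nbhd G k X, z ^ k / 2 := by
        rw [Finset.sum_const, nsmul_eq_mul, D, hdeg, mul_div_assoc]
    _ ≤ _ := Finset.sum_le_sum hterm

end DetInput

/-! ### Numerical estimates for large `m` -/

theorem seven_le_gExp {l : ℕ} (hl : 2 ≤ l) : 7 ≤ gExp l := by
  have : (2 : ℝ) ^ 4 ≤ 2 ^ (l + 2) := pow_le_pow_right₀ (by norm_num) (by omega)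
  rw [gExp]
  linarith

theorem half_mul_pow_le_one (k : ℕ) : (1 / 2 * 0.99 ^ k : ℝ) ≤ 1 := by
  have : (0.99 : ℝ) ^ k ≤ 1 := pow_le_one₀ (by norm_num) (by norm_num)
  linarith

namespace DetInput

variable {V : Type*} [Fintype V] [DecidableEq V] (P : DetInput V)

/-- The standing assumptions on the input, for large `m` and `v > 1`. -/
structure Admissible : Prop where
  rank : ∀ e ∈ P.edges, e.card ≤ P.r
  one_lt_v : 1 < P.v
  v_le : P.v ≤ (P.m : ℝ) ^ 3
  constrained : IsConstrained P.m P.r P.edges P.v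
  approxIndep : ApproxIndep P.Ω (1001 * P.lm)
  edgeIndep : EdgeIndep P.Ω P.edges
  le_lm : 2 ^ 200 ≤ P.lm
  two_pow_r_mul_le : 2 ^ P.r * Real.log P.lm ≤ P.lm

namespace Admissible

variable {P} (hP : P.Admissible)

include hP

theorem v_pos : 0 < P.v := zero_lt_one.trans hP.one_lt_v

theorem lm_large : 10 ^ 20 ≤ P.lm := le_trans (by norm_num) hP.le_lm

theorem lm_pos : 0 < P.lm := lt_of_lt_of_le (by norm_num) hP.le_lm

theorem one_le_lm : 1 ≤ P.lm := le_trans (by norm_num) hP.le_lm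

theorem m_pos : (0 : ℝ) < P.m := by
  rcases Nat.eq_zero_or_pos P.m with h | h
  · have := hP.lm_pos
    rw [lm, h, Nat.cast_zero, Real.log_zero] at this
    exact absurd this (lt_irrefl _)
  · exact Nat.cast_pos.2 h

theorem exp_lm : Real.exp P.lm = P.m := Real.exp_log hP.m_pos

theorem lm_le_m : P.lm ≤ P.m := by
  have := Real.add_one_le_exp P.lm
  rw [hP.exp_lm] at this
  linarith

theorem one_le_log_lm : 1 ≤ Real.log P.lm := by
  rw [Real.le_log_iff_exp_le hP.lm_pos]
  have := Real.exp_one_lt_d9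
  have := hP.lm_large
  linarith

theorem two_pow_r_le : (2 : ℝ) ^ P.r ≤ P.lm := by
  have h1 := hP.one_le_log_lm
  have h2 := hP.two_pow_r_mul_le
  have h3 : (0 : ℝ) < 2 ^ P.r := by positivity
  nlinarith

theorem two_pow_le {k : ℕ} (hk : k ≤ P.r) : (2 : ℝ) ^ k ≤ P.lm :=
  (pow_le_pow_right₀ (by norm_num) hk).trans hP.two_pow_r_le

theorem r_le : (P.r : ℝ) ≤ P.lm := by
  have h : (P.r : ℝ) ≤ 2 ^ P.r := by exact_mod_cast Nat.lt_two_pow_self.le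
  exact h.trans hP.two_pow_r_le

theorem r_mul_log_two_le : P.r * Real.log 2 ≤ Real.log P.lm := by
  rw [← Real.log_pow]
  exact Real.log_le_log (by positivity) hP.two_pow_r_le

theorem v_le_two_pow_s : P.v ≤ 2 ^ P.s := by
  calc P.v = (2 : ℝ) ^ (Real.logb 2 P.v) :=
        (Real.rpow_logb (by norm_num) (by norm_num) hP.v_pos).symm
    _ ≤ (2 : ℝ) ^ (P.s : ℝ) := Real.rpow_le_rpow_of_exponent_le (by norm_num) (Nat.le_ceil _)
    _ = _ := Real.rpow_natCast _ _

theorem two_pow_s_le : (2 : ℝ) ^ P.s ≤ 2 * P.v := by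
  have h0 : 0 ≤ Real.logb 2 P.v := Real.logb_nonneg (by norm_num) hP.one_lt_v.le
  calc (2 : ℝ) ^ P.s = (2 : ℝ) ^ (P.s : ℝ) := (Real.rpow_natCast _ _).symm
    _ ≤ (2 : ℝ) ^ (Real.logb 2 P.v + 1) :=
        Real.rpow_le_rpow_of_exponent_le (by norm_num) (Nat.ceil_lt_add_one h0).le
    _ = 2 * P.v := by
        rw [Real.rpow_add (by norm_num), Real.rpow_logb (by norm_num) (by norm_num) hP.v_pos,
          Real.rpow_one, mul_comm]

theorem half_pow_s_le : ((1 : ℝ) / 2) ^ P.s ≤ P.v⁻¹ := by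
  rw [one_div, inv_pow]
  exact inv_anti₀ hP.v_pos hP.v_le_two_pow_s

theorem le_half_pow_s : (2 * P.v)⁻¹ ≤ ((1 : ℝ) / 2) ^ P.s := by
  rw [one_div, inv_pow]
  exact inv_anti₀ (by positivity) hP.two_pow_s_le

theorem four_pow_s_le : (4 : ℝ) ^ P.s ≤ (P.m : ℝ) ^ 7 := by
  have h1 : (4 : ℝ) ^ P.s = (2 ^ P.s) ^ 2 := by
    rw [← pow_mul, mul_comm, pow_mul]
    norm_num
  have hm : 4 ≤ (P.m : ℝ) := le_trans (by norm_num) (hP.lm_large.trans hP.lm_le_m)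
  have hm0 := hP.m_pos
  calc (4 : ℝ) ^ P.s ≤ (2 * P.v) ^ 2 := by
        rw [h1]; exact pow_le_pow_left₀ (by positivity) hP.two_pow_s_le 2
    _ ≤ (2 * (P.m : ℝ) ^ 3) ^ 2 := by
        have := hP.v_pos
        exact pow_le_pow_left₀ (by positivity) (by linarith [hP.v_le]) 2
    _ = 4 * (P.m : ℝ) ^ 6 := by ring
    _ ≤ P.m * (P.m : ℝ) ^ 6 := mul_le_mul_of_nonneg_right hm (by positivity)
    _ = _ := by ring

/-- The number of rounds is polynomial in `m` precisely because `2 ^ r * log log m` is at most `log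
m`. -/
theorem T_le : (P.T : ℝ) ≤ (P.m : ℝ) ^ 4 := by
  have h0 := hP.lm_pos
  calc (P.T : ℝ) ≤ P.lm ^ (2 ^ (P.r + 2)) := Nat.floor_le (by positivity)
    _ = Real.exp (Real.log P.lm * (2 ^ (P.r + 2) : ℕ)) := by
        rw [← Real.rpow_natCast, Real.rpow_def_of_pos h0]
    _ ≤ Real.exp (4 * P.lm) := by
        apply Real.exp_le_exp.2
        have := hP.two_pow_r_mul_le
        push_cast
        rw [pow_add]
        linarith
    _ = _ := by
        rw [← hP.exp_lm, ← Real.exp_nat_mul]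
        norm_num

theorem wExp_pos {q : ℕ} (hq : 1 ≤ q) : 0 < P.wExp q := by
  have := hP.lm_pos
  have : (0 : ℝ) < q := Nat.cast_pos.2 hq
  rw [wExp, Nat.ceil_pos]
  positivity

theorem le_wExp (q : ℕ) : 1000 * P.lm / q ≤ P.wExp q := Nat.le_ceil _

/-- The moments involve up to `w * q` positions. Rounding `w` up adds at most `q ≤ r ≤ log m`, which
explains the constant 1001. -/
theorem wExp_mul_le {q : ℕ} (hq : 1 ≤ q) (hqr : q ≤ P.r) : P.wExp q * (q : ℝ) ≤ 1001 * P.lm := by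
  have h0 := hP.lm_pos
  have hq0 : (0 : ℝ) < q := Nat.cast_pos.2 hq
  have h1 : (P.wExp q : ℝ) ≤ 1000 * P.lm / q + 1 := (Nat.ceil_lt_add_one (by positivity)).le
  have h2 : (q : ℝ) ≤ P.r := Nat.cast_le.2 hqr
  have h3 := hP.r_le
  calc P.wExp q * (q : ℝ) ≤ (1000 * P.lm / q + 1) * q := mul_le_mul_of_nonneg_right h1 hq0.le
    _ = 1000 * P.lm + q := by field_simp
    _ ≤ _ := by linarith

theorem wExp_le {q : ℕ} (hq : 1 ≤ q) (hqr : q ≤ P.r) : (P.wExp q : ℝ) ≤ 1001 * P.lm := by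
  have h1 := hP.wExp_mul_le hq hqr
  have h2 : (1 : ℝ) ≤ q := by exact_mod_cast hq
  have h3 : (0 : ℝ) ≤ P.wExp q := Nat.cast_nonneg _
  nlinarith

/-- This is the value of a current (S1) summand at the start of its round, when the quotient is at
most `2 / log m`. -/
theorem four_pow_mul_le {q : ℕ} (hq : 1 ≤ q) (hqr : q ≤ P.r) :
    (4 : ℝ) ^ P.s * (2 / P.lm) ^ P.wExp q ≤ ((P.m : ℝ) ^ 100)⁻¹ := by
  have h0 := hP.lm_pos
  have hm0 := hP.m_pos
  have hq0 : (0 : ℝ) < q := Nat.cast_pos.2 hq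
  have hlog : Real.log P.lm / 2 ≤ Real.log (P.lm / 2) := by
    rw [Real.log_div h0.ne' (by norm_num)]
    have : 2 * Real.log 2 ≤ Real.log P.lm := by
      rw [← Real.log_rpow (by norm_num)]
      refine Real.log_le_log (by positivity) (le_trans ?_ hP.lm_large)
      norm_num
    linarith
  -- Of the exponent 107, the prefactor `4 ^ s` consumes 7. Since `q` is at most a constant times
  -- `log log m`, the quotient `w ≥ 1000 log m / q` even gives 250.
  have hmain : 107 * P.lm ≤ P.wExp q * Real.log (P.lm / 2) := by
    have h1 : (q : ℝ) * Real.log 2 ≤ Real.log P.lm :=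
      le_trans (mul_le_mul_of_nonneg_right (Nat.cast_le.2 hqr) (Real.log_nonneg (by norm_num)))
        hP.r_mul_log_two_le
    have h2 := Real.log_two_gt_d9
    have h3 := hP.le_wExp q
    have h4 : (q : ℝ) * 0.5 ≤ Real.log P.lm := by nlinarith
    calc 107 * P.lm ≤ 1000 * P.lm / q * (q * 0.5 / 2) := by
          have : 1000 * P.lm / q * (q * 0.5 / 2) = 250 * P.lm := by field_simp; norm_num
          rw [this]; linarith
      _ ≤ P.wExp q * Real.log (P.lm / 2) := by
          apply mul_le_mul h3 (by linarith) (by positivity) (Nat.cast_nonneg _)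
  have hpow : (P.m : ℝ) ^ 107 ≤ (P.lm / 2) ^ P.wExp q := by
    rw [← hP.exp_lm, ← Real.exp_nat_mul, ← Real.rpow_natCast, Real.rpow_def_of_pos (by positivity)]
    apply Real.exp_le_exp.2
    rw [mul_comm (Real.log _)]
    exact_mod_cast hmain
  have hinv : (2 / P.lm) ^ P.wExp q ≤ ((P.m : ℝ) ^ 107)⁻¹ := by
    rw [← inv_div, inv_pow]
    exact inv_anti₀ (by positivity) hpow
  calc _ ≤ (P.m : ℝ) ^ 7 * ((P.m : ℝ) ^ 107)⁻¹ :=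
        mul_le_mul hP.four_pow_s_le hinv (by positivity) (by positivity)
    _ = _ := by field_simp

theorem one_sub_pow_le {c : ℝ} (hc1 : c ≤ 1) {τ : ℕ} (h : 100 * P.lm ≤ c * τ) :
    (1 - c) ^ τ ≤ ((P.m : ℝ) ^ 100)⁻¹ := by
  calc (1 - c) ^ τ ≤ (Real.exp (-c)) ^ τ :=
        pow_le_pow_left₀ (by linarith) (by linarith [Real.add_one_le_exp (-c)]) τ
    _ = Real.exp (-(c * τ)) := by rw [← Real.exp_nat_mul]; ring_nf
    _ ≤ Real.exp (-(100 * P.lm)) := Real.exp_le_exp.2 (by linarith)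
    _ = _ := by
        rw [Real.exp_neg, ← hP.exp_lm, ← Real.exp_nat_mul]
        norm_num

/-- The threshold `2 ^ 200` makes a hundredth power of `log m` absorb small constants; this is the
origin of the 0.01 in 5.01. -/
theorem four_le_lm_rpow : 4 ≤ P.lm ^ (0.01 : ℝ) := by
  calc (4 : ℝ) = ((2 : ℝ) ^ (200 : ℝ)) ^ (0.01 : ℝ) := by
        rw [← Real.rpow_mul (by norm_num)]; norm_num
    _ ≤ P.lm ^ (0.01 : ℝ) := by
        refine Real.rpow_le_rpow (by positivity) ?_ (by norm_num)
        exact_mod_cast hP.le_lm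

theorem two_pow_twenty_le_lm_rpow : 2 ^ 20 ≤ P.lm ^ (0.1 : ℝ) := by
  calc (2 : ℝ) ^ 20 = ((2 : ℝ) ^ (200 : ℝ)) ^ (0.1 : ℝ) := by
        rw [← Real.rpow_mul (by norm_num), ← Real.rpow_natCast]; norm_num
    _ ≤ P.lm ^ (0.1 : ℝ) := by
        refine Real.rpow_le_rpow (by positivity) ?_ (by norm_num)
        exact_mod_cast hP.le_lm

theorem lm_rpow_le {a b : ℝ} (h : a ≤ b) : P.lm ^ a ≤ P.lm ^ b :=
  Real.rpow_le_rpow_of_exponent_le hP.one_le_lm h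

/-- The decay rate times the window length is at least `100 log m`. -/
theorem rate_mul_floor_ge {k x : ℕ} (hk : k ≤ P.r) (hkx : 2 ≤ k + x) {a : ℝ}
    (ha1 : a ≤ 1) (ha0 : 0 ≤ a) (ha : 1 ≤ a ^ 2 * (4 * 2 ^ k)) :
    100 * P.lm ≤ (a * P.lm ^ (-gExp (k + x)) / 2 ^ (k + 1)) *
      ⌊a * P.lm ^ ((2 : ℝ) ^ (k + x + 2) - 5.01)⌋₊ := by
  have h0 := hP.lm_pos
  set E : ℝ := (2 : ℝ) ^ (k + x + 2) - 5.01 with hE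
  have hE10 : 10 ≤ E := by
    have : (2 : ℝ) ^ 4 ≤ 2 ^ (k + x + 2) := pow_le_pow_right₀ (by norm_num) (by omega)
    rw [hE]; linarith
  have h2k := hP.two_pow_le hk
  have h2k0 : (0 : ℝ) < 2 ^ k := by positivity
  have hlam := hP.lm_large
  -- Rounding the window length down loses at most a factor 2.
  have hfl : a * P.lm ^ E / 2 ≤ ⌊a * P.lm ^ E⌋₊ := by
    have h1 : (P.lm) ^ 10 ≤ P.lm ^ E := by
      rw [← Real.rpow_natCast]; exact hP.lm_rpow_le (by exact_mod_cast hE10)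
    have h2 : 2 ≤ a * P.lm ^ E := by
      have h3 : a ^ 2 ≤ a := by nlinarith
      have h4 : 1 ≤ a * (4 * P.lm) := by nlinarith
      have h5 : P.lm ^ 2 ≤ P.lm ^ E := (pow_le_pow_right₀ hP.one_le_lm (by norm_num)).trans h1
      nlinarith
    have := Nat.lt_floor_add_one (a * P.lm ^ E)
    linarith
  have hrate0 : 0 ≤ a * P.lm ^ (-gExp (k + x)) / 2 ^ (k + 1) := by positivity
  refine le_trans ?_ (mul_le_mul_of_nonneg_left hfl hrate0)
  -- The powers of 2 in the exponents cancel and leave `9 - 5.01 = 3.99`, enough to beat `log m`,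
  -- the factor `2 ^ k` and the square of `a`.
  have hprod : P.lm ^ (-gExp (k + x)) * P.lm ^ E = P.lm ^ (3 : ℕ) * P.lm ^ (0.99 : ℝ) := by
    rw [← Real.rpow_add h0, ← Real.rpow_natCast, ← Real.rpow_add h0, hE, gExp]
    norm_num
  have hcalc : a * P.lm ^ (-gExp (k + x)) / 2 ^ (k + 1) * (a * P.lm ^ E / 2) =
      a ^ 2 * (P.lm ^ (3 : ℕ) * P.lm ^ (0.99 : ℝ)) / (4 * 2 ^ k) := by
    rw [← hprod, pow_succ]
    field_simp
    norm_num
  rw [hcalc, le_div_iff₀ (by positivity)]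
  have h99 : 1600 ≤ P.lm ^ (0.99 : ℝ) :=
    le_trans (le_trans (by norm_num) hP.two_pow_twenty_le_lm_rpow) (hP.lm_rpow_le (by norm_num))
  have hR : P.lm ^ (3 : ℕ) * 1600 ≤ P.lm ^ (3 : ℕ) * P.lm ^ (0.99 : ℝ) :=
    mul_le_mul_of_nonneg_left h99 (by positivity)
  have h16 : 1 ≤ a ^ 2 * (4 * P.lm) := ha.trans (by gcongr)
  calc 100 * P.lm * (4 * 2 ^ k) ≤ 100 * P.lm * (4 * P.lm) := by gcongr
    _ ≤ 100 * P.lm * (4 * P.lm) * (a ^ 2 * (4 * P.lm)) := le_mul_of_one_le_right (by positivity) h16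
    _ = a ^ 2 * (P.lm ^ (3 : ℕ) * 1600) := by ring
    _ ≤ _ := by gcongr

theorem rate_gamma1 (k x : ℕ) : P.gamma1 k x / (2 ^ (k + 1) * P.v ^ k) =
    1 * P.lm ^ (-gExp (k + x)) / 2 ^ (k + 1) := by
  have := hP.v_pos
  rw [gamma1]
  field_simp

theorem rate_gamma2 (k x : ℕ) : P.gamma2 k x / (2 ^ (k + 1) * P.v ^ k) =
    (1 / 2 * 0.99 ^ k) * P.lm ^ (-gExp (k + x)) / 2 ^ (k + 1) := by
  have := hP.v_pos
  rw [gamma2, mul_pow]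
  field_simp

theorem rate_le_one {k x : ℕ} (hkx : 2 ≤ k + x) {a : ℝ} (ha1 : a ≤ 1) :
    a * P.lm ^ (-gExp (k + x)) / 2 ^ (k + 1) ≤ 1 := by
  have h0 := hP.lm_pos
  have h1 : P.lm ^ (-gExp (k + x)) ≤ 1 :=
    Real.rpow_le_one_of_one_le_of_nonpos hP.one_le_lm (by linarith [seven_le_gExp hkx])
  have h2 : (1 : ℝ) ≤ 2 ^ (k + 1) := one_le_pow₀ (by norm_num)
  rw [div_le_one (by positivity)]
  exact le_trans (mul_le_one₀ ha1 (by positivity) h1) h2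

theorem one_sub_rate1_pow_le {k x : ℕ} (hk : k ≤ P.r) (hkx : 2 ≤ k + x) :
    (1 - P.gamma1 k x / (2 ^ (k + 1) * P.v ^ k)) ^ P.tau1 k x ≤ ((P.m : ℝ) ^ 100)⁻¹ := by
  rw [hP.rate_gamma1]
  refine hP.one_sub_pow_le (hP.rate_le_one hkx le_rfl) ?_
  have h2 : (1 : ℝ) ≤ 2 ^ k := one_le_pow₀ (by norm_num)
  have := hP.rate_mul_floor_ge hk hkx (a := 1) le_rfl zero_le_one (by linarith)
  rw [tau1]
  simpa only [one_mul] using this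

theorem one_sub_rate2_pow_le {k x : ℕ} (hk : k ≤ P.r) (hkx : 2 ≤ k + x) :
    (1 - P.gamma2 k x / (2 ^ (k + 1) * P.v ^ k)) ^ P.tau2 k x ≤ ((P.m : ℝ) ^ 100)⁻¹ := by
  rw [hP.rate_gamma2]
  refine hP.one_sub_pow_le (hP.rate_le_one hkx (half_mul_pow_le_one k)) ?_
  refine hP.rate_mul_floor_ge hk hkx (half_mul_pow_le_one k) (by positivity) ?_
  have : (1 / 2 * 0.99 ^ k : ℝ) ^ 2 * (4 * 2 ^ k) = (0.99 * 0.99 * 2) ^ k := by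
    rw [mul_pow, mul_pow, mul_pow]
    ring
  rw [this]
  exact one_le_pow₀ (by norm_num)

/-- At time 0 every summand (S3) is therefore still before its window. -/
theorem tau2_lt_T {k x : ℕ} (hkx : k + x ≤ P.r) : P.tau2 k x < P.T := by
  have h0 := hP.lm_pos
  have h1 : P.lm ^ ((2 : ℝ) ^ (k + x + 2) - 5.01) ≤ P.lm ^ (2 ^ (P.r + 2)) := by
    rw [← Real.rpow_natCast P.lm]
    refine hP.lm_rpow_le ?_
    have : (2 : ℝ) ^ (k + x + 2) ≤ 2 ^ (P.r + 2) := pow_le_pow_right₀ (by norm_num) (by omega)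
    push_cast
    linarith
  have hT : P.lm ^ (2 ^ (P.r + 2)) < P.T + 1 := Nat.lt_floor_add_one _
  have hτ : (P.tau2 k x : ℝ) ≤ 1 / 2 * 0.99 ^ k * P.lm ^ ((2 : ℝ) ^ (k + x + 2) - 5.01) :=
    Nat.floor_le (by positivity)
  have hp : P.lm ≤ P.lm ^ (2 ^ (P.r + 2)) := le_self_pow₀ hP.one_le_lm (by positivity)
  have h99 : (0.99 : ℝ) ^ k ≤ 1 := pow_le_one₀ (by norm_num) (by norm_num)
  have hpos : 0 < P.lm ^ ((2 : ℝ) ^ (k + x + 2) - 5.01) := by positivity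
  have hl := hP.lm_large
  have : (P.tau2 k x : ℝ) < P.T := by nlinarith
  exact_mod_cast this

theorem tau1_pos {k x : ℕ} (hkx : 2 ≤ k + x) : 0 < P.tau1 k x := by
  rw [tau1, Nat.floor_pos]
  refine Real.one_le_rpow hP.one_le_lm ?_
  have : (2 : ℝ) ^ 4 ≤ 2 ^ (k + x + 2) := pow_le_pow_right₀ (by norm_num) (by omega)
  linarith

/-- The recursion `g (l + 1) = 2 * g l + 9` tunes the window: `tau1` increments add up to at most
`gamma1`, and the single additional round to at most `gamma1` again. -/
theorem tau1_succ_mul_le {j : ℕ} (hj : 1 ≤ j) (x : ℕ) :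
    ((P.tau1 j x : ℝ) + 1) * (P.v ^ j * P.lm ^ (-gExp (x + j + 1) + 5.01)) ≤
      2 * P.gamma1 j x := by
  have h0 := hP.lm_pos
  have hv := hP.v_pos
  have hpow : (2 : ℝ) ^ (x + j + 1 + 2) = 2 * 2 ^ (j + x + 2) := by ring
  have h1 : (P.tau1 j x : ℝ) * P.lm ^ (-gExp (x + j + 1) + 5.01) ≤ P.lm ^ (-gExp (j + x)) := by
    calc (P.tau1 j x : ℝ) * P.lm ^ (-gExp (x + j + 1) + 5.01) ≤
        P.lm ^ ((2 : ℝ) ^ (j + x + 2) - 5.01) * P.lm ^ (-gExp (x + j + 1) + 5.01) :=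
          mul_le_mul_of_nonneg_right (Nat.floor_le (by positivity)) (by positivity)
      _ = P.lm ^ (-gExp (j + x)) := by
          rw [← Real.rpow_add h0]
          congr 1
          rw [gExp, gExp, hpow]
          ring
  have h2 : P.lm ^ (-gExp (x + j + 1) + 5.01) ≤ P.lm ^ (-gExp (j + x)) := by
    refine hP.lm_rpow_le ?_
    have : (2 : ℝ) ^ 3 ≤ 2 ^ (j + x + 2) := pow_le_pow_right₀ (by norm_num) (by omega)
    rw [gExp, gExp, hpow]
    linarith
  rw [gamma1]
  have := mul_le_mul_of_nonneg_left (add_le_add h1 h2) (pow_nonneg hv.le j)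
  linarith

end Admissible

end DetInput

/-! ### The summands (S1) -/

namespace DetInput

variable {V : Type*} [Fintype V] [DecidableEq V] (P : DetInput V)

/-- All degrees at time `t` exceed the bounds of a constrained hypergraph by at most a
factor 3. -/
def DegBound (B : ℕ → ℕ → Finset V) (t : ℕ) : Prop :=
  ∀ X : Finset V, X.Nonempty → ∀ j : ℕ, 1 ≤ j → (P.D B t j X : ℝ) ≤ 3 * P.gamma1 j X.card

/-- The additive term in the numerator of the summands (S1). -/
noncomputable def psiBase (k j x d : ℕ) : ℝ := P.v ^ j * P.lm ^ (-gExp (k + x) + 4 * d)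

theorem mem_sets {X : Finset V} :
    X ∈ P.sets ↔ 0 < X.card ∧ X.card < P.r ∧ ∃ e ∈ P.edges, X ⊆ e := by
  simp [sets]

theorem mem_subsets {X Y : Finset V} {q : ℕ} :
    Y ∈ P.subsets X q ↔ Disjoint X Y ∧ Y.card < q ∧ ∃ e ∈ P.edges, Y ⊆ e := by
  simp [subsets]

theorem avg_sum_le (Ω : PMF (Finset V)) {ι : Type*} (s : Finset ι) (f : Finset V → ι → ℝ)
    (g : ι → ℝ) (h : ∀ i ∈ s, ∑ b, (Ω b).toReal * f b i ≤ g i) :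
    ∑ b, (Ω b).toReal * ∑ i ∈ s, f b i ≤ ∑ i ∈ s, g i := by
  simp_rw [Finset.mul_sum]
  rw [Finset.sum_comm]
  exact Finset.sum_le_sum h

theorem avg_const (Ω : PMF (Finset V)) (c : ℝ) : ∑ b, (Ω b).toReal * c = c := by
  rw [← Finset.sum_mul, sum_toReal_eq_one, one_mul]

theorem H_setBits_succ (B : ℕ → ℕ → Finset V) (t j q : ℕ) (X : Finset V) (i : ℕ) (Y b : Finset V) :
    P.H (setBits B t i b) t j q X (i + 1) Y =
      ∑ Z with Disjoint X Z ∧ Y ⊆ Z ∧ Z.card = q ∧ Z ⊆ marks B t i ∩ b,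
        (P.D B t j (X ∪ Z) : ℝ) := by
  simp only [H, marks_setBits_succ, P.D_setBits B t i b le_rfl]

theorem H_setBits_of_lt (B : ℕ → ℕ → Finset V) {t u : ℕ} (h : u < t) (j q : ℕ) (X : Finset V)
    (i a : ℕ) (Y b : Finset V) :
    P.H (setBits B t i b) u j q X a Y = P.H B u j q X a Y := by
  simp only [H, marks_setBits_of_ne B h.ne, P.D_setBits B t i b h.le]

namespace Admissible

variable {P} (hP : P.Admissible)

include hP

theorem psiBase_pos (k j x d : ℕ) : 0 < P.psiBase k j x d := by
  have := hP.v_pos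
  have := hP.lm_pos
  rw [psiBase]
  positivity

theorem psiBase_mul_lm (k j x d : ℕ) :
    P.v ^ j * P.lm ^ (-gExp (k + x) + 4 * d + 1) = P.psiBase k j x d * P.lm := by
  rw [psiBase, Real.rpow_add_one hP.lm_pos.ne', mul_assoc]

theorem Psi_current (B : ℕ → ℕ → Finset V) (i t k j : ℕ) (X Y : Finset V) :
    P.Psi B t i t k j X Y = 4 ^ (P.s - i) *
      ((P.psiBase k j X.card (k - j - Y.card) +
        P.H B t j (k - j) X i Y * ((2 : ℝ) ^ ((P.s - i) * (k - j - Y.card)))⁻¹) /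
        (P.psiBase k j X.card (k - j - Y.card) * P.lm)) ^ P.wExp (k - j) := by
  simp only [Psi, lt_irrefl, if_false, if_true]
  rw [hP.psiBase_mul_lm, psiBase]

theorem Psi_past (B : ℕ → ℕ → Finset V) {l t : ℕ} (h : t < l) (i k j : ℕ) (X Y : Finset V) :
    P.Psi B l i t k j X Y =
      ((P.psiBase k j X.card (k - j - Y.card) + P.H B t j (k - j) X P.s Y) /
        (P.psiBase k j X.card (k - j - Y.card) * P.lm)) ^ P.wExp (k - j) := by
  simp only [Psi, h.not_gt, h.ne', if_false]
  rw [hP.psiBase_mul_lm, psiBase]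

theorem Psi_nonneg (B : ℕ → ℕ → Finset V) (l i t k j : ℕ) (X Y : Finset V) :
    0 ≤ P.Psi B l i t k j X Y := by
  have h0 := hP.lm_pos
  have hb := hP.psiBase_pos k j X.card (k - j - Y.card)
  rcases lt_trichotomy l t with h | h | h
  · simp only [Psi, h, if_true]
    positivity
  · subst h
    rw [hP.Psi_current]
    have := P.H_nonneg B l j (k - j) X i Y
    positivity
  · rw [hP.Psi_past B h]
    have := P.H_nonneg B t j (k - j) X P.s Y
    positivity

/-- The transition between rounds for past summands. -/
theorem Psi_succ_zero (B : ℕ → ℕ → Finset V) {l t : ℕ} (h : t ≤ l) (k j : ℕ) (X Y : Finset V) :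
    P.Psi B (l + 1) 0 t k j X Y = P.Psi B l P.s t k j X Y := by
  rcases h.lt_or_eq with h | h
  · rw [hP.Psi_past B h, hP.Psi_past B (h.trans (Nat.lt_succ_self l))]
  · subst h
    rw [hP.Psi_past B (Nat.lt_succ_self t), hP.Psi_current]
    simp

/-- Otherwise the base of the power would be at least 1, and the prefactor is at least 1 too. -/
theorem H_scaled_lt_of_Psi_lt_one {B : ℕ → ℕ → Finset V} {i t k j : ℕ} {X Y : Finset V}
    (hjk : j < k) (h : P.Psi B t i t k j X Y < 1) :
    P.H B t j (k - j) X i Y * ((2 : ℝ) ^ ((P.s - i) * (k - j - Y.card)))⁻¹ ≤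
      P.psiBase k j X.card (k - j - Y.card) * P.lm := by
  have h0 := hP.lm_pos
  have hb := hP.psiBase_pos k j X.card (k - j - Y.card)
  have hw := hP.wExp_pos (q := k - j) (by omega)
  rw [hP.Psi_current] at h
  by_contra hlt
  push Not at hlt
  have h1 : 1 ≤ (P.psiBase k j X.card (k - j - Y.card) +
        P.H B t j (k - j) X i Y * ((2 : ℝ) ^ ((P.s - i) * (k - j - Y.card)))⁻¹) /
        (P.psiBase k j X.card (k - j - Y.card) * P.lm) := by
    rw [one_le_div (by positivity)]
    linarith
  have h2 := one_le_pow₀ h1 (n := P.wExp (k - j))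
  have h3 : (1 : ℝ) ≤ 4 ^ (P.s - i) := one_le_pow₀ (by norm_num)
  nlinarith

/-- The scaled sums `H` are small as long as all current summands (S1) are below 1. -/
theorem H_scaled_le {B : ℕ → ℕ → Finset V} {i t k j : ℕ} {X Y : Finset V}
    (hX : X.Nonempty) (hj : 1 ≤ j) (hjk : j < k) (hdeg : P.DegBound B t)
    (h : ∀ Y ∈ P.subsets X (k - j), P.Psi B t i t k j X Y < 1) (hXY : Disjoint X Y)
    (hY : Y.card ≤ k - j) :
    P.H B t j (k - j) X i Y * ((2 : ℝ) ^ ((P.s - i) * (k - j - Y.card)))⁻¹ ≤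
      P.psiBase k j X.card (k - j - Y.card) * P.lm := by
  have h0 := hP.lm_pos
  have hb := hP.psiBase_pos k j X.card (k - j - Y.card)
  by_cases hedge : ∃ e ∈ P.edges, Y ⊆ e
  · rcases hY.lt_or_eq with hlt | heq
    · exact hP.H_scaled_lt_of_Psi_lt_one hjk (h Y (P.mem_subsets.2 ⟨hXY, hlt, hedge⟩))
    -- Sets with exactly `q` elements have no summand in the potential. Here `H` is at most the
    -- single degree of `X ∪ Y`, which `DegBound` controls.
    · rw [heq, Nat.sub_self, mul_zero, pow_zero, inv_one, mul_one]
      have hH : P.H B t j (k - j) X i Y ≤ P.D B t j (X ∪ Y) := by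
        rw [H, ← Finset.sum_singleton (fun Z => (P.D B t j (X ∪ Z) : ℝ)) Y]
        refine Finset.sum_le_sum_of_subset_of_nonneg ?_ fun _ _ _ => Nat.cast_nonneg _
        intro Z hZ
        rw [Finset.mem_filter] at hZ
        rw [Finset.mem_singleton]
        exact (Finset.eq_of_subset_of_card_le hZ.2.2.1 (by omega)).symm
      have hD := hdeg (X ∪ Y) (hX.mono Finset.subset_union_left) j hj
      have hcard : j + (X ∪ Y).card = k + X.card := by
        rw [Finset.card_union_of_disjoint hXY]
        omega
      have hγ : P.gamma1 j (X ∪ Y).card = P.psiBase k j X.card 0 := by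
        rw [gamma1, psiBase, hcard]
        simp
      rw [hγ] at hD
      have hb0 := hP.psiBase_pos k j X.card 0
      have := hP.lm_large
      nlinarith
  · push Not at hedge
    rw [P.H_eq_zero_of_not_subset B t hj _ hX i hedge, zero_mul]
    positivity

/-- Each vertex forced to be marked lowers the allowed size by `(log m) ^ 4`. This is the role of
the term `4 * (q - y)` in the exponent: it beats the at most `1001 log m` choices for that vertex.
-/
theorem psiBase_sub (k j x : ℕ) {d p : ℕ} (h : p ≤ d) :
    P.psiBase k j x (d - p) = P.psiBase k j x d * (P.lm ^ 4)⁻¹ ^ p := by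
  have h0 := hP.lm_pos
  rw [psiBase, psiBase, mul_assoc, inv_pow, ← pow_mul, ← Real.rpow_natCast P.lm, ← Real.rpow_neg h0.le,
    ← Real.rpow_add h0, Nat.cast_sub h]
  congr 2
  push_cast
  ring

/-- With no bits fixed, `H` is at most `2 ^ (j + d)` times the `(j + d)`-degree of `X ∪ Y`.
`DegBound` and the scaling `2 ^ (-s d) ≤ v ^ (-d)` bring this below the base, since `(log m) ^ (-4
d)` beats `3 * 2 ^ (j + d)`. -/
theorem psi_zero_le {B : ℕ → ℕ → Finset V} {t k j : ℕ} {X Y : Finset V}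
    (hX : X.Nonempty) (hj : 1 ≤ j) (hjk : j < k) (hk : k ≤ P.r) (hdeg : P.DegBound B t)
    (hY : Y ∈ P.subsets X (k - j)) :
    P.Psi B t 0 t k j X Y ≤ ((P.m : ℝ) ^ 100)⁻¹ := by
  have h0 := hP.lm_pos
  have hv := hP.v_pos
  obtain ⟨hXY, hYc, -⟩ := P.mem_subsets.1 hY
  set d := k - j - Y.card with hd
  set β := P.psiBase k j X.card d with hβ
  have hb : 0 < β := hP.psiBase_pos k j X.card d
  have hH : P.H B t j (k - j) X 0 Y ≤ 2 ^ (j + d) * P.D B t (j + d) (X ∪ Y) := by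
    have := sum_hdeg_union_le (P.graph B t) j (k - j) X Y hYc.le
    have he : j + (k - j) - Y.card = j + d := by omega
    rw [he] at this
    simpa only [H, D, marks_zero, Finset.subset_univ, and_true] using this
  have hD := hdeg (X ∪ Y) (hX.mono Finset.subset_union_left) (j + d) (by omega)
  have hcard : j + d + (X ∪ Y).card = k + X.card := by
    rw [Finset.card_union_of_disjoint hXY]
    omega
  have hγ : P.gamma1 (j + d) (X ∪ Y).card = P.v ^ d * P.psiBase k j X.card 0 := by
    rw [gamma1, psiBase, hcard, pow_add]
    simp
    ring
  have hβ0 : P.psiBase k j X.card 0 = β * (P.lm ^ 4)⁻¹ ^ d := by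
    rw [← Nat.sub_self d, hP.psiBase_sub k j X.card le_rfl]
  have hs : ((2 : ℝ) ^ (P.s * d))⁻¹ ≤ (P.v ^ d)⁻¹ := by
    rw [pow_mul]
    exact inv_anti₀ (by positivity) (pow_le_pow_left₀ hv.le hP.v_le_two_pow_s d)
  have hscaled : P.H B t j (k - j) X 0 Y * ((2 : ℝ) ^ (P.s * d))⁻¹ ≤ β := by
    calc P.H B t j (k - j) X 0 Y * ((2 : ℝ) ^ (P.s * d))⁻¹ ≤
        (2 ^ (j + d) * (3 * (P.v ^ d * (β * (P.lm ^ 4)⁻¹ ^ d)))) * (P.v ^ d)⁻¹ := by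
          refine mul_le_mul ?_ hs (by positivity) (by positivity)
          refine hH.trans (mul_le_mul_of_nonneg_left ?_ (by positivity))
          rw [← hβ0, ← hγ]
          exact hD
      _ = (3 * 2 ^ (j + d) * (P.lm ^ 4)⁻¹ ^ d) * β := by field_simp
      _ ≤ 1 * β := by
          refine mul_le_mul_of_nonneg_right ?_ hb.le
          have h1 : ((P.lm ^ 4)⁻¹ ^ d : ℝ) ≤ (P.lm ^ 4)⁻¹ := by
            refine pow_le_of_le_one (by positivity) ?_ (by omega)
            exact inv_le_one_of_one_le₀ (one_le_pow₀ hP.one_le_lm)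
          have h2 := hP.two_pow_le (k := j + d) (by omega)
          calc 3 * 2 ^ (j + d) * (P.lm ^ 4)⁻¹ ^ d ≤ 3 * P.lm * (P.lm ^ 4)⁻¹ := by gcongr
            _ = 3 / P.lm ^ 3 := by field_simp
            _ ≤ 1 := by
                rw [div_le_one (by positivity)]
                have := hP.lm_large
                have h3 : P.lm ≤ P.lm ^ 3 := le_self_pow₀ hP.one_le_lm (by norm_num)
                linarith
      _ = β := one_mul β
  rw [hP.Psi_current, Nat.sub_zero, ← hd, ← hβ]
  have hH0 := P.H_nonneg B t j (k - j) X 0 Y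
  refine le_trans ?_ (hP.four_pow_mul_le (q := k - j) (by omega) (by omega))
  refine mul_le_mul_of_nonneg_left ?_ (by positivity)
  refine pow_le_pow_left₀ (by positivity) ?_ _
  rw [div_le_div_iff₀ (by positivity) h0]
  nlinarith

/-- The exponent is at most `1001 log m`, and `1001 / 2000` is below `log 2`. -/
theorem one_add_pow_wExp_le {q : ℕ} (hq : 1 ≤ q) (hqr : q ≤ P.r) :
    (1 + 1 / (2000 * P.lm)) ^ P.wExp q ≤ 2 := by
  have h0 := hP.lm_pos
  calc (1 + 1 / (2000 * P.lm)) ^ P.wExp q ≤ Real.exp (1 / (2000 * P.lm)) ^ P.wExp q := by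
        refine pow_le_pow_left₀ (by positivity) ?_ _
        linarith [Real.add_one_le_exp (1 / (2000 * P.lm))]
    _ = Real.exp (P.wExp q * (1 / (2000 * P.lm))) := by rw [← Real.exp_nat_mul]
    _ ≤ Real.exp (Real.log 2) := by
        refine Real.exp_le_exp.2 ?_
        have h1 := hP.wExp_le hq hqr
        have h2 := Real.log_two_gt_d9
        rw [mul_one_div, div_le_iff₀ (by positivity)]
        nlinarith
    _ = 2 := Real.exp_log (by norm_num)

/-- A geometric series with ratio at most `1001 / (log m) ^ 3`. The index `p + 1` counts the
vertices of `Z \ Y` that are already forced. -/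
theorem sum_range_pow_succ_le {U : ℝ} (hU0 : 0 ≤ U) (hU : U ≤ 1001 * P.lm) (d : ℕ) :
    ∑ p ∈ Finset.range d, U ^ (p + 1) * (P.lm * (P.lm ^ 4)⁻¹ ^ (p + 1)) ≤
      1 / (2000 * P.lm) := by
  have h0 := hP.lm_pos
  have hl := hP.lm_large
  set y : ℝ := 1001 / P.lm ^ 3 with hy
  have hy0 : 0 ≤ y := by positivity
  have hy2 : y ≤ 1 / 2 := by
    rw [hy, div_le_div_iff₀ (by positivity) (by norm_num)]
    have h3 : P.lm ≤ P.lm ^ 3 := le_self_pow₀ hP.one_le_lm (by norm_num)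
    linarith
  have hterm : ∀ p ∈ Finset.range d, U ^ (p + 1) * (P.lm * (P.lm ^ 4)⁻¹ ^ (p + 1)) ≤
      P.lm * y * (1 / 2) ^ p := by
    intro p _
    have hbase : U * (P.lm ^ 4)⁻¹ ≤ y := by
      calc U * (P.lm ^ 4)⁻¹ ≤ 1001 * P.lm * (P.lm ^ 4)⁻¹ := by gcongr
        _ = y := by rw [hy]; field_simp
    calc U ^ (p + 1) * (P.lm * (P.lm ^ 4)⁻¹ ^ (p + 1)) = P.lm * (U * (P.lm ^ 4)⁻¹) ^ (p + 1) := by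
          rw [mul_pow]; ring
      _ ≤ P.lm * y ^ (p + 1) := by gcongr
      _ = P.lm * y * y ^ p := by ring
      _ ≤ P.lm * y * (1 / 2) ^ p := by gcongr
  refine (Finset.sum_le_sum hterm).trans ?_
  rw [← Finset.mul_sum]
  have hgeom : ∑ p ∈ Finset.range d, ((1 : ℝ) / 2) ^ p ≤ 2 := sum_geometric_two_le d
  calc P.lm * y * ∑ p ∈ Finset.range d, ((1 : ℝ) / 2) ^ p ≤ P.lm * y * 2 := by gcongr
    _ = 2002 / P.lm ^ 2 := by rw [hy]; field_simp; norm_num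
    _ ≤ 1 / (2000 * P.lm) := by
        rw [div_le_div_iff₀ (by positivity) (by positivity)]
        nlinarith

/-- The influence of a small set of bits on the expectation of `H`. -/
theorem sum_weights_le {B : ℕ → ℕ → Finset V} {i t k j : ℕ} {X Y : Finset V} (hi : i < P.s)
    (hX : X.Nonempty) (hj : 1 ≤ j) (hjk : j < k) (hdeg : P.DegBound B t)
    (h : ∀ Y ∈ P.subsets X (k - j), P.Psi B t i t k j X Y < 1) (hXY : Disjoint X Y)
    (U : Finset V) (hU : (U.card : ℝ) ≤ 1001 * P.lm) :
    ∑ Z with Disjoint X Z ∧ Y ⊆ Z ∧ Z.card = k - j ∧ Z ⊆ marks B t i,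
      (P.D B t j (X ∪ Z) * ((2 : ℝ) ^ ((P.s - (i + 1)) * (k - j - Y.card)))⁻¹) *
        (1 / 2) ^ ((Z \ Y) \ U).card ≤
      P.H B t j (k - j) X i Y * ((2 : ℝ) ^ ((P.s - i) * (k - j - Y.card)))⁻¹ +
        P.psiBase k j X.card (k - j - Y.card) * (1 / (2000 * P.lm)) := by
  have h0 := hP.lm_pos
  set d := k - j - Y.card with hd
  set β := P.psiBase k j X.card d with hβ
  have hb : 0 < β := hP.psiBase_pos k j X.card d
  set 𝓩 : Finset (Finset V) := Finset.univ.filter fun Z =>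
    Disjoint X Z ∧ Y ⊆ Z ∧ Z.card = k - j ∧ Z ⊆ marks B t i with h𝓩
  set a : Finset V → ℝ := fun Z =>
    P.D B t j (X ∪ Z) * ((2 : ℝ) ^ ((P.s - (i + 1)) * d))⁻¹ with ha
  have ha0 : ∀ Z, 0 ≤ a Z := fun Z => by positivity
  have hcardZ : ∀ Z ∈ 𝓩, (Z \ Y).card = d := by
    intro Z hZ
    rw [h𝓩, Finset.mem_filter] at hZ
    rw [Finset.card_sdiff_of_subset hZ.2.2.1, hZ.2.2.2.1]
  -- The sets `Z` are sorted by the forced part `Y' = (Z \ Y) ∩ U`. With no forced vertex the bound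
  -- is the current mean; otherwise it is `H_scaled_le` for `Y ∪ Y'`.
  have hfib : ∀ p ≤ d, ∀ Y' ∈ U.powersetCard p,
      ∑ Z ∈ 𝓩 with (Z \ Y) ∩ U = Y', a Z * (1 / 2) ^ ((Z \ Y) \ U).card ≤
        if p = 0 then P.H B t j (k - j) X i Y * ((2 : ℝ) ^ ((P.s - i) * d))⁻¹
        else β * (P.lm * (P.lm ^ 4)⁻¹ ^ p) := by
    intro p hp Y' hY'
    obtain ⟨hY'U, hY'c⟩ := Finset.mem_powersetCard.1 hY'
    rcases (𝓩.filter fun Z => (Z \ Y) ∩ U = Y').eq_empty_or_nonempty with hemp | ⟨Z₀, hZ₀⟩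
    · rw [hemp, Finset.sum_empty]
      have := P.H_nonneg B t j (k - j) X i Y
      split_ifs <;> positivity
    have hY'Z : ∀ Z, Z \ Y ∩ U = Y' → Y' ⊆ Z \ Y := fun Z hZ => hZ ▸ Finset.inter_subset_left
    have hYY' : Disjoint Y Y' := by
      rw [Finset.mem_filter] at hZ₀
      exact Finset.disjoint_sdiff.mono_right (hY'Z Z₀ hZ₀.2)
    have hXY' : Disjoint X (Y ∪ Y') := by
      rw [Finset.mem_filter, h𝓩, Finset.mem_filter] at hZ₀
      exact Finset.disjoint_union_right.2 ⟨hXY,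
        hZ₀.1.2.1.mono_right ((hY'Z Z₀ hZ₀.2).trans Finset.sdiff_subset)⟩
    have hc : (Y ∪ Y').card = Y.card + p := by
      rw [Finset.card_union_of_disjoint hYY', hY'c]
    have hsum : ∑ Z ∈ 𝓩 with (Z \ Y) ∩ U = Y', a Z * (1 / 2) ^ ((Z \ Y) \ U).card ≤
        P.H B t j (k - j) X i (Y ∪ Y') * ((2 : ℝ) ^ ((P.s - i) * (d - p)))⁻¹ := by
      rw [H, Finset.sum_mul]
      refine (Finset.sum_le_sum (g := fun Z => (P.D B t j (X ∪ Z) : ℝ) *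
        ((2 : ℝ) ^ ((P.s - i) * (d - p)))⁻¹) ?_).trans
        (Finset.sum_le_sum_of_subset_of_nonneg ?_ fun _ _ _ => by positivity)
      · intro Z hZ
        rw [Finset.mem_filter] at hZ
        have hc1 : ((Z \ Y) \ U).card = d - p := by
          have := Finset.card_sdiff_add_card_inter (Z \ Y) U
          rw [hcardZ Z hZ.1, hZ.2, hY'c] at this
          omega
        rw [hc1, ha]
        simp only
        rw [mul_assoc]
        refine mul_le_mul_of_nonneg_left ?_ (Nat.cast_nonneg _)
        rw [one_div, inv_pow, ← mul_inv, ← pow_add]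
        refine inv_anti₀ (by positivity) (pow_le_pow_right₀ (by norm_num) ?_)
        -- The claim on exponents is `(c + 1) * (d - p) ≤ c * d + (d - p)`: the `p` forced vertices
        -- lose their factor in the present stage only.
        obtain ⟨c, hc⟩ : ∃ c, P.s - i = c + 1 := ⟨P.s - (i + 1), by omega⟩
        have hc' : P.s - (i + 1) = c := by omega
        rw [hc, hc', add_mul, one_mul]
        exact Nat.add_le_add_right (Nat.mul_le_mul_left c (Nat.sub_le d p)) _
      · intro Z hZ
        rw [Finset.mem_filter, h𝓩, Finset.mem_filter] at hZ
        rw [Finset.mem_filter]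
        exact ⟨Finset.mem_univ _, hZ.1.2.1, Finset.union_subset hZ.1.2.2.1
          ((hY'Z Z hZ.2).trans Finset.sdiff_subset), hZ.1.2.2.2⟩
    refine hsum.trans ?_
    split_ifs with hp0
    · subst hp0
      rw [Finset.card_eq_zero] at hY'c
      rw [hY'c, Finset.union_empty, Nat.sub_zero]
    · have := hP.H_scaled_le (i := i) hX hj hjk hdeg h hXY' (by omega)
      have he : k - j - (Y ∪ Y').card = d - p := by omega
      rw [he, hP.psiBase_sub k j X.card hp, ← hβ] at this
      linarith
  have hsplit : ∑ Z ∈ 𝓩, a Z * (1 / 2) ^ ((Z \ Y) \ U).card =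
      ∑ p ∈ Finset.range (d + 1), ∑ Y' ∈ U.powersetCard p,
        ∑ Z ∈ 𝓩 with (Z \ Y) ∩ U = Y', a Z * (1 / 2) ^ ((Z \ Y) \ U).card := by
    rw [← Finset.sum_fiberwise_of_maps_to (s := 𝓩) (t := Finset.range (d + 1))
      (g := fun Z => ((Z \ Y) ∩ U).card)]
    · refine Finset.sum_congr rfl fun p _ => ?_
      rw [← Finset.sum_fiberwise_of_maps_to (s := 𝓩.filter _) (t := U.powersetCard p)
        (g := fun Z => (Z \ Y) ∩ U)]
      · refine Finset.sum_congr rfl fun Y' hY' => ?_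
        refine Finset.sum_congr ?_ fun _ _ => rfl
        ext Z
        simp only [Finset.mem_filter]
        have := (Finset.mem_powersetCard.1 hY').2
        constructor
        · rintro ⟨⟨h1, _⟩, h2⟩
          exact ⟨h1, h2⟩
        · rintro ⟨h1, h2⟩
          exact ⟨⟨h1, by rw [h2, this]⟩, h2⟩
      · intro Z hZ
        exact Finset.mem_powersetCard.2 ⟨Finset.inter_subset_right, (Finset.mem_filter.1 hZ).2⟩
    · intro Z hZ
      rw [Finset.mem_range]
      have := Finset.card_le_card (Finset.inter_subset_left : (Z \ Y) ∩ U ⊆ Z \ Y)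
      rw [hcardZ Z hZ] at this
      omega
  rw [hsplit]
  calc _ ≤ ∑ p ∈ Finset.range (d + 1), ∑ Y' ∈ U.powersetCard p,
        (if p = 0 then P.H B t j (k - j) X i Y * ((2 : ℝ) ^ ((P.s - i) * d))⁻¹
        else β * (P.lm * (P.lm ^ 4)⁻¹ ^ p)) :=
        Finset.sum_le_sum fun p hp => Finset.sum_le_sum fun Y' hY' =>
          hfib p (by rw [Finset.mem_range] at hp; omega) Y' hY'
    _ = P.H B t j (k - j) X i Y * ((2 : ℝ) ^ ((P.s - i) * d))⁻¹ +
        ∑ p ∈ Finset.range d, (U.card.choose (p + 1)) * (β * (P.lm * (P.lm ^ 4)⁻¹ ^ (p + 1))) := by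
        rw [Finset.sum_range_succ', add_comm]
        simp [Finset.card_powersetCard]
    _ ≤ _ := by
        refine add_le_add le_rfl ?_
        refine le_trans ?_ (mul_le_mul_of_nonneg_left
          (hP.sum_range_pow_succ_le (Nat.cast_nonneg U.card) hU d) hb.le)
        rw [Finset.mul_sum]
        refine Finset.sum_le_sum fun p _ => ?_
        have hch : ((U.card.choose (p + 1) : ℕ) : ℝ) ≤ (U.card : ℝ) ^ (p + 1) := by
          exact_mod_cast Nat.choose_le_pow U.card (p + 1)
        calc _ ≤ (U.card : ℝ) ^ (p + 1) * (β * (P.lm * (P.lm ^ 4)⁻¹ ^ (p + 1))) := by gcongr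
          _ = _ := by ring

/-- The expectation of a current summand (S1) does not increase in a stage. -/
theorem avg_Psi_current_le {B : ℕ → ℕ → Finset V} {i t k j : ℕ} {X Y : Finset V} (hi : i < P.s)
    (hX : X.Nonempty) (hj : 1 ≤ j) (hjk : j < k) (hk : k ≤ P.r) (hdeg : P.DegBound B t)
    (h : ∀ Y ∈ P.subsets X (k - j), P.Psi B t i t k j X Y < 1) (hY : Y ∈ P.subsets X (k - j)) :
    ∑ b, (P.Ω b).toReal * P.Psi (setBits B t i b) t (i + 1) t k j X Y ≤
      P.Psi B t i t k j X Y := by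
  have h0 := hP.lm_pos
  obtain ⟨hXY, hYc, -⟩ := P.mem_subsets.1 hY
  simp_rw [hP.Psi_current]
  set d := k - j - Y.card with hd
  set β := P.psiBase k j X.card d with hβ
  have hb : 0 < β := hP.psiBase_pos k j X.card d
  set w := P.wExp (k - j) with hw
  set μ := P.H B t j (k - j) X i Y * ((2 : ℝ) ^ ((P.s - i) * d))⁻¹ with hμ
  have hμ0 : 0 ≤ μ := mul_nonneg (P.H_nonneg _ _ _ _ _ _ _) (by positivity)
  set 𝓩 : Finset (Finset V) := Finset.univ.filter fun Z =>
    Disjoint X Z ∧ Y ⊆ Z ∧ Z.card = k - j ∧ Z ⊆ marks B t i with h𝓩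
  set a : Finset V → ℝ := fun Z =>
    P.D B t j (X ∪ Z) * ((2 : ℝ) ^ ((P.s - (i + 1)) * d))⁻¹ with ha
  have ha0 : ∀ Z, 0 ≤ a Z := fun Z => by positivity
  -- Only `Z \ Y` is required to lie in `b`; dropping the condition on `Y` enlarges the sum and
  -- leaves sets of exactly `d` new positions.
  have hHb : ∀ b : Finset V, P.H (setBits B t i b) t j (k - j) X (i + 1) Y *
      ((2 : ℝ) ^ ((P.s - (i + 1)) * d))⁻¹ ≤ ∑ Z ∈ 𝓩, a Z * (if Z \ Y ⊆ b then 1 else 0) := by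
    intro b
    rw [H_setBits_succ, Finset.sum_mul]
    refine Finset.sum_le_sum_of_injOn_maps id ?_ Function.injective_id.injOn ?_ ?_
    · intro Z hZ
      simp only [h𝓩, Finset.mem_filter, Finset.mem_univ, true_and, Finset.subset_inter_iff,
        id] at hZ ⊢
      tauto
    · intro Z hZ
      simp only [Finset.mem_filter, Finset.mem_univ, true_and, Finset.subset_inter_iff] at hZ
      rw [id, if_pos (Finset.sdiff_subset.trans hZ.2.2.2.2), mul_one]
    · intro Z _
      have := ha0 Z
      positivity
  have hmom := hP.approxIndep.moment_le 𝓩 (fun Z _ => ha0 Z) (fun Z => Z \ Y) (d := d)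
    (fun Z hZ => by
      rw [h𝓩, Finset.mem_filter] at hZ
      rw [Finset.card_sdiff_of_subset hZ.2.2.1, hZ.2.2.2.1]) hb.le
    (M := μ + β * (1 / (2000 * P.lm))) (by positivity)
    (fun U hU => hP.sum_weights_le hi hX hj hjk hdeg h hXY U hU) w ∅ (by
      rw [Finset.card_empty, Nat.cast_zero, zero_add]
      refine le_trans ?_ (hP.wExp_mul_le (q := k - j) (by omega) (by omega))
      exact mul_le_mul_of_nonneg_left (Nat.cast_le.2 (Nat.sub_le _ _)) (Nat.cast_nonneg _))
  simp only [Finset.empty_subset, if_true, mul_one, Finset.card_empty, pow_zero] at hmom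
  -- One factor 2 comes from the influence of forced bits and another from approximate independence;
  -- their product 4 is what the prefactor loses in a stage.
  have hbound : (β + (μ + β * (1 / (2000 * P.lm)))) ^ w ≤ 2 * (β + μ) ^ w := by
    calc (β + (μ + β * (1 / (2000 * P.lm)))) ^ w ≤
        ((1 + 1 / (2000 * P.lm)) * (β + μ)) ^ w := by
          refine pow_le_pow_left₀ (by positivity) ?_ w
          have : 0 ≤ 1 / (2000 * P.lm) * μ := by positivity
          linarith
      _ = (1 + 1 / (2000 * P.lm)) ^ w * (β + μ) ^ w := mul_pow _ _ _
      _ ≤ 2 * (β + μ) ^ w := mul_le_mul_of_nonneg_right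
          (hP.one_add_pow_wExp_le (by omega) (by omega)) (by positivity)
  have hs : (4 : ℝ) ^ (P.s - i) = 4 * 4 ^ (P.s - (i + 1)) := by
    rw [← pow_succ']
    congr 1
    omega
  calc _ ≤ ∑ b, (4 ^ (P.s - (i + 1)) / (β * P.lm) ^ w) *
        ((P.Ω b).toReal * (β + ∑ Z ∈ 𝓩, a Z * (if Z \ Y ⊆ b then 1 else 0)) ^ w) := by
        refine Finset.sum_le_sum fun b _ => ?_
        have hH0 := P.H_nonneg (setBits B t i b) t j (k - j) X (i + 1) Y
        have h1 : (β + P.H (setBits B t i b) t j (k - j) X (i + 1) Y *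
            ((2 : ℝ) ^ ((P.s - (i + 1)) * d))⁻¹) ^ w ≤
            (β + ∑ Z ∈ 𝓩, a Z * (if Z \ Y ⊆ b then 1 else 0)) ^ w :=
          pow_le_pow_left₀ (by positivity) (by linarith [hHb b]) w
        rw [div_pow]
        calc _ = (4 ^ (P.s - (i + 1)) / (β * P.lm) ^ w) * ((P.Ω b).toReal *
              (β + P.H (setBits B t i b) t j (k - j) X (i + 1) Y *
                ((2 : ℝ) ^ ((P.s - (i + 1)) * d))⁻¹) ^ w) := by ring
          _ ≤ _ := by gcongr
    _ ≤ (4 ^ (P.s - (i + 1)) / (β * P.lm) ^ w) * (4 * (β + μ) ^ w) := by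
        rw [← Finset.mul_sum]
        refine mul_le_mul_of_nonneg_left ?_ (by positivity)
        linarith
    _ = _ := by rw [hs, div_pow]; ring

end Admissible

end DetInput

/-! ### The summands (S2) and (S3) -/

namespace DetInput

variable {V : Type*} [Fintype V] [DecidableEq V] (P : DetInput V)

theorem phi_nonneg (B : ℕ → ℕ → Finset V) (l i τ : ℕ) {γ : ℝ} (t : ℕ) {k : ℕ}
    (hc : γ / (2 ^ (k + 1) * P.v ^ k) ≤ 1) (X : Finset V) : 0 ≤ P.phi B l i τ γ t k X := by
  have h1 : 0 ≤ 1 - γ / (2 ^ (k + 1) * P.v ^ k) := by linarith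
  have h2 : 0 ≤ 1 - P.expCollapse B l i k X := by linarith [P.expCollapse_le_one B l i k X]
  rw [phi]
  split_ifs <;> positivity

theorem avg_expCollapse (B : ℕ → ℕ → Finset V) (l k : ℕ) {i : ℕ} (hi : i < P.s) (X : Finset V) :
    ∑ b, (P.Ω b).toReal * P.expCollapse (setBits B l i b) l (i + 1) k X =
      P.expCollapse B l i k X := by
  obtain ⟨a, ha⟩ : ∃ a, P.s - i = a + 1 := ⟨P.s - (i + 1), by omega⟩
  have ha' : P.s - (i + 1) = a := by omega
  simp only [expCollapse, marks_setBits_succ, P.graph_setBits B l i _ le_rfl, ha, ha', expectMarks]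

/-- The expectation of a summand (S2) or (S3) does not change in a stage. -/
theorem avg_phi (B : ℕ → ℕ → Finset V) (l : ℕ) {i : ℕ} (hi : i < P.s) (τ : ℕ) (γ : ℝ) (t k : ℕ)
    (X : Finset V) :
    ∑ b, (P.Ω b).toReal * P.phi (setBits B l i b) l (i + 1) τ γ t k X =
      P.phi B l i τ γ t k X := by
  have hwin : ∀ b, ∀ u' ≤ l, (∀ u ∈ Finset.Icc (t - τ) u', γ < P.D (setBits B l i b) u k X) ↔
      ∀ u ∈ Finset.Icc (t - τ) u', γ < P.D B u k X := by
    intro b u' hu'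
    refine forall₂_congr fun u hu => ?_
    rw [P.D_setBits B l i b ((Finset.mem_Icc.1 hu).2.trans hu')]
  by_cases h1 : t ≤ l
  · simp only [phi, h1, if_true, hwin _ t h1]
    exact avg_const _ _
  by_cases h2 : l < t - τ
  · simp only [phi, h1, h2, if_true, if_false]
    exact avg_const _ _
  simp only [phi, h1, h2, if_false, hwin _ l le_rfl]
  split_ifs
  · simp_rw [← mul_assoc]
    rw [← Finset.sum_mul]
    congr 1
    simp_rw [mul_sub, mul_one]
    rw [Finset.sum_sub_distrib, sum_toReal_eq_one, P.avg_expCollapse B l k hi]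
  · simp

/-- The transition between rounds for a summand (S2) or (S3). -/
theorem phi_succ_zero_le (B : ℕ → ℕ → Finset V) (l τ : ℕ) {γ : ℝ} (hγ : 0 ≤ γ) (t : ℕ) {k : ℕ}
    (hk : 1 ≤ k) {X : Finset V} (hX : X.Nonempty) (hc : γ / (2 ^ (k + 1) * P.v ^ k) ≤ 1)
    (hcol : γ < P.D B (l + 1) k X →
      γ / (2 ^ (k + 1) * P.v ^ k) ≤ P.expCollapse B (l + 1) 0 k X) :
    P.phi B (l + 1) 0 τ γ t k X ≤ P.phi B l P.s τ γ t k X := by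
  set c := γ / (2 ^ (k + 1) * P.v ^ k) with hcdef
  have h1c : 0 ≤ 1 - c := by linarith
  have hnn := P.phi_nonneg B l P.s τ t hc X
  -- After the last stage the expectation is the estimator itself. A positive value would mean that
  -- `X` collapsed, against its degree still exceeding `γ ≥ 0`. So the factor `1 - expCollapse` has
  -- become at least 1.
  have hcollapse : γ < P.D B (l + 1) k X → P.expCollapse B l P.s k X ≤ 0 := by
    intro hD
    by_contra hpos
    push Not at hpos
    rw [expCollapse, Nat.sub_self, expectMarks] at hpos
    rw [P.D_succ_eq_zero_of_collapseEst_pos hX hk hpos, Nat.cast_zero] at hD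
    linarith
  rcases le_or_gt t l with h | h
  · simp only [phi, h, h.trans (Nat.le_succ l), if_true, le_refl]
  rcases Nat.lt_or_ge (l + 1) (t - τ) with h2 | h2
  · have h3 : ¬ t ≤ l + 1 := by omega
    have h4 : ¬ t ≤ l := by omega
    have h5 : l < t - τ := by omega
    simp only [phi, h2, h3, h4, h5, if_true, if_false, le_refl]
  by_cases hall : ∀ u ∈ Finset.Icc (t - τ) (l + 1), γ < P.D B u k X
  swap
  · refine le_trans (le_of_eq ?_) hnn
    rcases Nat.lt_or_ge (l + 1) t with h3 | h3
    · simp only [phi, not_le.2 h3, not_lt.2 h2, hall, if_false]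
    · obtain rfl : t = l + 1 := by omega
      simp only [phi, le_refl, if_true, hall, if_false]
  have hD := hall (l + 1) (Finset.mem_Icc.2 ⟨h2, le_rfl⟩)
  have hall' : ∀ u ∈ Finset.Icc (t - τ) l, γ < P.D B u k X := fun u hu =>
    hall u (Finset.Icc_subset_Icc le_rfl (Nat.le_succ l) hu)
  have hpow : 0 ≤ (1 - c) ^ (t - l - 1) := by positivity
  have hold : (1 - c) ^ (t - l - 1) ≤ P.phi B l P.s τ γ t k X := by
    by_cases h5 : l < t - τ
    · simp only [phi, not_le.2 h, h5, if_true, if_false, ← hcdef]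
      -- Time `l + 1` is the first of the window here, so that exactly `τ` factors remain.
      have : t - l - 1 = τ ∨ τ = 0 ∧ t - l - 1 = 0 := by omega
      rcases this with h6 | ⟨h6, h7⟩
      · rw [h6]
      · rw [h6, h7]
    · simp only [phi, not_le.2 h, h5, if_false, ← hcdef]
      rw [if_pos hall']
      have := hcollapse hD
      nlinarith
  refine le_trans ?_ hold
  rcases Nat.lt_or_ge (l + 1) t with h3 | h3
  · simp only [phi, not_le.2 h3, not_lt.2 h2, if_false, ← hcdef]
    rw [if_pos hall]
    -- The chance to collapse in the coming round is at least `c`, which pays for one of the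
    -- remaining factors `1 - c`.
    have hE := hcol hD
    obtain ⟨e, he⟩ : ∃ e, t - l - 1 = e + 1 := ⟨t - (l + 1) - 1, by omega⟩
    have he' : t - (l + 1) - 1 = e := by omega
    rw [he, he', pow_succ']
    exact mul_le_mul_of_nonneg_right (by linarith) (by positivity)
  · obtain rfl : t = l + 1 := by omega
    simp only [phi, le_refl, if_true]
    rw [if_pos hall]
    simp

namespace Admissible

variable {P} (hP : P.Admissible)

include hP

theorem gamma1_nonneg (k x : ℕ) : 0 ≤ P.gamma1 k x := by
  have := hP.v_pos
  have := hP.lm_pos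
  rw [gamma1]
  positivity

theorem gamma2_nonneg (k x : ℕ) : 0 ≤ P.gamma2 k x := by
  have := hP.v_pos
  have := hP.lm_pos
  rw [gamma2]
  positivity

theorem rate1_le_one {k x : ℕ} (hkx : 2 ≤ k + x) :
    P.gamma1 k x / (2 ^ (k + 1) * P.v ^ k) ≤ 1 := by
  rw [hP.rate_gamma1]
  exact hP.rate_le_one hkx le_rfl

theorem rate2_le_one {k x : ℕ} (hkx : 2 ≤ k + x) :
    P.gamma2 k x / (2 ^ (k + 1) * P.v ^ k) ≤ 1 := by
  rw [hP.rate_gamma2]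
  exact hP.rate_le_one hkx (half_mul_pow_le_one k)

/-- Since `2 ^ (-s) ≥ 1 / (2 v)`, half of the main term `D * 2 ^ (-s k)` is at least `γ / (2 ^ (k +
1) * v ^ k)`; this is where the rate `c` comes from. The errors are small because `g ≥ 7` makes all
scaled degrees at most `3 / (log m) ^ 7`. -/
theorem rate_le_expCollapse {B : ℕ → ℕ → Finset V} {t : ℕ} (hdeg : P.DegBound B (t + 1)) {k : ℕ}
    (hk : 1 ≤ k) (hkr : k ≤ P.r) {X : Finset V} (hX : X.Nonempty) {γ : ℝ}
    (hD : γ < P.D B (t + 1) k X) :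
    γ / (2 ^ (k + 1) * P.v ^ k) ≤ P.expCollapse B (t + 1) 0 k X := by
  have h0 := hP.lm_pos
  have hv := hP.v_pos
  have hl := hP.lm_large
  have hbound : ∀ X : Finset V, X.Nonempty → ∀ j, 1 ≤ j →
      (P.D B (t + 1) j X : ℝ) * ((1 / 2) ^ P.s) ^ j ≤ 3 * (P.lm ^ 7)⁻¹ := by
    intro X hX j hj
    have hX0 := hX.card_pos
    have h1 : P.lm ^ (-gExp (j + X.card)) ≤ (P.lm ^ 7)⁻¹ := by
      rw [← Real.rpow_natCast, ← Real.rpow_neg h0.le]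
      refine hP.lm_rpow_le ?_
      have := seven_le_gExp (l := j + X.card) (by omega)
      push_cast
      linarith
    calc (P.D B (t + 1) j X : ℝ) * ((1 / 2) ^ P.s) ^ j ≤
        (3 * P.gamma1 j X.card) * (P.v⁻¹) ^ j := by
          have := hP.gamma1_nonneg j X.card
          refine mul_le_mul (hdeg X hX j hj) ?_ (by positivity) (by positivity)
          exact pow_le_pow_left₀ (by positivity) hP.half_pow_s_le j
      _ = 3 * P.lm ^ (-gExp (j + X.card)) := by
          rw [gamma1, inv_pow]
          field_simp
      _ ≤ _ := by linarith
  have hsmall : 2 ^ k * (P.r * (3 * (P.lm ^ 7)⁻¹)) + 2 ^ k * (3 * (P.lm ^ 7)⁻¹) ≤ 1 / 2 := by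
    have h2 := hP.two_pow_le hkr
    have hr := hP.r_le
    calc 2 ^ k * (P.r * (3 * (P.lm ^ 7)⁻¹)) + 2 ^ k * (3 * (P.lm ^ 7)⁻¹) ≤
        P.lm * (P.lm * (3 * (P.lm ^ 7)⁻¹)) + P.lm * (P.lm * (3 * (P.lm ^ 7)⁻¹)) := by
          have h1 := hP.one_le_lm
          refine add_le_add (by gcongr) ?_
          refine mul_le_mul h2 ?_ (by positivity) h0.le
          exact le_mul_of_one_le_left (by positivity) h1
      _ = 6 / P.lm ^ 5 := by field_simp; norm_num
      _ ≤ 1 / 2 := by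
          rw [div_le_div_iff₀ (by positivity) (by norm_num)]
          have h3 : P.lm ≤ P.lm ^ 5 := le_self_pow₀ hP.one_le_lm (by norm_num)
          linarith
  have hmain := P.le_expCollapse hP.rank hP.edgeIndep B t k hk hX (by positivity) hbound hsmall
  refine le_trans ?_ hmain
  have hz : ((2 * P.v)⁻¹) ^ k ≤ (((1 : ℝ) / 2) ^ P.s) ^ k :=
    pow_le_pow_left₀ (by positivity) hP.le_half_pow_s k
  calc γ / (2 ^ (k + 1) * P.v ^ k) ≤ P.D B (t + 1) k X / (2 ^ (k + 1) * P.v ^ k) := by gcongr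
    _ = P.D B (t + 1) k X * ((2 * P.v)⁻¹) ^ k / 2 := by
        rw [inv_pow, mul_pow, pow_succ]
        field_simp
    _ ≤ _ := by gcongr

theorem two_le_of_mem_sets {X : Finset V} (hX : X ∈ P.sets) {k : ℕ} (hk : 1 ≤ k) :
    2 ≤ k + X.card := by
  have := (P.mem_sets.1 hX).1
  omega

theorem nonempty_of_mem_sets {X : Finset V} (hX : X ∈ P.sets) : X.Nonempty :=
  Finset.card_pos.1 (P.mem_sets.1 hX).1

/-! ### The potential within a round and between rounds -/

theorem sum1_nonneg (B : ℕ → ℕ → Finset V) (l i : ℕ) :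
    0 ≤ ∑ t ∈ Finset.range P.T, ∑ X ∈ P.sets, ∑ k ∈ Finset.Icc 1 P.r, ∑ j ∈ Finset.Ico 1 k,
      ∑ Y ∈ P.subsets X (k - j), P.Psi B l i t k j X Y :=
  Finset.sum_nonneg fun _ _ => Finset.sum_nonneg fun _ _ => Finset.sum_nonneg fun _ _ =>
    Finset.sum_nonneg fun _ _ => Finset.sum_nonneg fun _ _ => hP.Psi_nonneg _ _ _ _ _ _ _ _

theorem phi1_nonneg (B : ℕ → ℕ → Finset V) (l i t : ℕ) {X : Finset V} (hX : X ∈ P.sets) {j : ℕ}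
    (hj : j ∈ Finset.Icc 1 (P.r - X.card)) :
    0 ≤ P.phi B l i (P.tau1 j X.card) (P.gamma1 j X.card) t j X :=
  P.phi_nonneg B l i _ t
    (hP.rate1_le_one (hP.two_le_of_mem_sets hX (Finset.mem_Icc.1 hj).1)) X

theorem phi2_nonneg (B : ℕ → ℕ → Finset V) (l i t : ℕ) {X : Finset V} (hX : X ∈ P.sets) {j : ℕ}
    (hj : j ∈ Finset.Icc 1 (P.r - X.card)) :
    0 ≤ P.phi B l i (P.tau2 j X.card) (P.gamma2 j X.card) t j X :=
  P.phi_nonneg B l i _ t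
    (hP.rate2_le_one (hP.two_le_of_mem_sets hX (Finset.mem_Icc.1 hj).1)) X

theorem sum2_nonneg (B : ℕ → ℕ → Finset V) (l i : ℕ) :
    0 ≤ ∑ X ∈ P.sets, ∑ j ∈ Finset.Icc 1 (P.r - X.card), ∑ t ∈ Finset.Icc (P.tau1 j X.card) P.T,
      P.phi B l i (P.tau1 j X.card) (P.gamma1 j X.card) t j X :=
  Finset.sum_nonneg fun _ hX => Finset.sum_nonneg fun _ hj => Finset.sum_nonneg fun _ _ =>
    hP.phi1_nonneg B l i _ hX hj

theorem sum3_nonneg (B : ℕ → ℕ → Finset V) (l i : ℕ) :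
    0 ≤ ∑ X ∈ P.sets, ∑ j ∈ Finset.Icc 1 (P.r - X.card),
      P.phi B l i (P.tau2 j X.card) (P.gamma2 j X.card) P.T j X :=
  Finset.sum_nonneg fun _ hX => Finset.sum_nonneg fun _ hj => hP.phi2_nonneg B l i _ hX hj

theorem Psi_le_potential (B : ℕ → ℕ → Finset V) (l i : ℕ) {t k j : ℕ} {X Y : Finset V}
    (ht : t < P.T) (hX : X ∈ P.sets) (hj : 1 ≤ j) (hjk : j < k) (hk : k ≤ P.r)
    (hY : Y ∈ P.subsets X (k - j)) : P.Psi B l i t k j X Y ≤ P.potential B l i := by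
  have hn := hP.Psi_nonneg B l i
  have h5 : P.Psi B l i t k j X Y ≤ ∑ Y ∈ P.subsets X (k - j), P.Psi B l i t k j X Y :=
    Finset.single_le_sum (f := fun Y => P.Psi B l i t k j X Y) (fun _ _ => hn _ _ _ _ _) hY
  have h4 := Finset.single_le_sum
    (f := fun j => ∑ Y ∈ P.subsets X (k - j), P.Psi B l i t k j X Y)
    (fun _ _ => Finset.sum_nonneg fun _ _ => hn _ _ _ _ _) (Finset.mem_Ico.2 ⟨hj, hjk⟩)
  have h3 := Finset.single_le_sum
    (f := fun k => ∑ j ∈ Finset.Ico 1 k, ∑ Y ∈ P.subsets X (k - j), P.Psi B l i t k j X Y)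
    (fun _ _ => Finset.sum_nonneg fun _ _ => Finset.sum_nonneg fun _ _ => hn _ _ _ _ _)
    (Finset.mem_Icc.2 ⟨(hj.trans hjk.le : 1 ≤ k), hk⟩)
  have h2 := Finset.single_le_sum
    (f := fun X => ∑ k ∈ Finset.Icc 1 P.r, ∑ j ∈ Finset.Ico 1 k,
      ∑ Y ∈ P.subsets X (k - j), P.Psi B l i t k j X Y)
    (fun _ _ => Finset.sum_nonneg fun _ _ => Finset.sum_nonneg fun _ _ =>
      Finset.sum_nonneg fun _ _ => hn _ _ _ _ _) hX
  have h1 := Finset.single_le_sum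
    (f := fun t => ∑ X ∈ P.sets, ∑ k ∈ Finset.Icc 1 P.r, ∑ j ∈ Finset.Ico 1 k,
      ∑ Y ∈ P.subsets X (k - j), P.Psi B l i t k j X Y)
    (fun _ _ => Finset.sum_nonneg fun _ _ => Finset.sum_nonneg fun _ _ =>
      Finset.sum_nonneg fun _ _ => Finset.sum_nonneg fun _ _ => hn _ _ _ _ _)
    (Finset.mem_range.2 ht)
  have h6 := hP.sum2_nonneg B l i
  have h7 := hP.sum3_nonneg B l i
  rw [potential]
  exact (((h5.trans h4).trans (h3.trans (h2.trans h1))).trans (le_add_of_nonneg_right h6)).trans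
    (le_add_of_nonneg_right h7)

theorem phi1_le_potential (B : ℕ → ℕ → Finset V) (l i : ℕ) {t j : ℕ} {X : Finset V}
    (hX : X ∈ P.sets) (hj : j ∈ Finset.Icc 1 (P.r - X.card)) (ht : P.tau1 j X.card ≤ t)
    (htT : t ≤ P.T) :
    P.phi B l i (P.tau1 j X.card) (P.gamma1 j X.card) t j X ≤ P.potential B l i := by
  set f : Finset V → ℕ → ℕ → ℝ := fun X j t =>
    P.phi B l i (P.tau1 j X.card) (P.gamma1 j X.card) t j X with hf
  have hf0 : ∀ X ∈ P.sets, ∀ j ∈ Finset.Icc 1 (P.r - X.card), ∀ t, 0 ≤ f X j t :=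
    fun X hX j hj t => hP.phi1_nonneg B l i t hX hj
  have h3 : f X j t ≤ ∑ t ∈ Finset.Icc (P.tau1 j X.card) P.T, f X j t :=
    Finset.single_le_sum (fun t _ => hf0 X hX j hj t) (Finset.mem_Icc.2 ⟨ht, htT⟩)
  have h2 : ∑ t ∈ Finset.Icc (P.tau1 j X.card) P.T, f X j t ≤
      ∑ j ∈ Finset.Icc 1 (P.r - X.card), ∑ t ∈ Finset.Icc (P.tau1 j X.card) P.T, f X j t :=
    Finset.single_le_sum (f := fun j => ∑ t ∈ Finset.Icc (P.tau1 j X.card) P.T, f X j t)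
      (fun j hj => Finset.sum_nonneg fun t _ => hf0 X hX j hj t) hj
  have h1 : ∑ j ∈ Finset.Icc 1 (P.r - X.card), ∑ t ∈ Finset.Icc (P.tau1 j X.card) P.T, f X j t ≤
      ∑ X ∈ P.sets, ∑ j ∈ Finset.Icc 1 (P.r - X.card),
        ∑ t ∈ Finset.Icc (P.tau1 j X.card) P.T, f X j t := by
    have hnn : ∀ X ∈ P.sets, 0 ≤ ∑ j ∈ Finset.Icc 1 (P.r - X.card),
        ∑ t ∈ Finset.Icc (P.tau1 j X.card) P.T, f X j t := fun X hX =>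
      Finset.sum_nonneg fun j hj => Finset.sum_nonneg fun t _ => hf0 X hX j hj t
    have := Finset.single_le_sum hnn hX
    exact this
  have h6 := hP.sum1_nonneg B l i
  have h7 := hP.sum3_nonneg B l i
  rw [potential]
  exact ((h3.trans (h2.trans h1)).trans (le_add_of_nonneg_left h6)).trans
    (le_add_of_nonneg_right h7)

/-- Future summands are constant and past ones do not depend on the new bits. Only the current ones
need the moment estimate, and the potential below 1 supplies its hypothesis on all `Y` at once. -/
theorem avg_Psi_le {B : ℕ → ℕ → Finset V} {l i : ℕ} (hi : i < P.s) (hdeg : P.DegBound B l)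
    (hpot : P.potential B l i < 1) {t k j : ℕ} {X Y : Finset V} (ht : t < P.T)
    (hX : X ∈ P.sets) (hj : 1 ≤ j) (hjk : j < k) (hk : k ≤ P.r) (hY : Y ∈ P.subsets X (k - j)) :
    ∑ b, (P.Ω b).toReal * P.Psi (setBits B l i b) l (i + 1) t k j X Y ≤ P.Psi B l i t k j X Y := by
  rcases lt_trichotomy l t with h | h | h
  · simp only [Psi, h, if_true]
    exact (avg_const _ _).le
  · subst h
    exact hP.avg_Psi_current_le hi (hP.nonempty_of_mem_sets hX) hj hjk hk hdeg
      (fun Y hY => (hP.Psi_le_potential B l i ht hX hj hjk hk hY).trans_lt hpot) hY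
  · simp only [hP.Psi_past _ h, P.H_setBits_of_lt B h]
    exact (avg_const _ _).le

/-- In each stage the expected potential does not increase. -/
theorem avg_potential_le {B : ℕ → ℕ → Finset V} {l i : ℕ} (hi : i < P.s) (hdeg : P.DegBound B l)
    (hpot : P.potential B l i < 1) :
    ∑ b, (P.Ω b).toReal * P.potential (setBits B l i b) l (i + 1) ≤ P.potential B l i := by
  simp only [potential, mul_add, Finset.sum_add_distrib]
  refine add_le_add (add_le_add ?_ ?_) ?_
  · refine avg_sum_le _ _ _ _ fun t ht => avg_sum_le _ _ _ _ fun X hX =>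
      avg_sum_le _ _ _ _ fun k hk => avg_sum_le _ _ _ _ fun j hj =>
      avg_sum_le _ _ _ _ fun Y hY => ?_
    rw [Finset.mem_Icc] at hk
    rw [Finset.mem_Ico] at hj
    exact hP.avg_Psi_le hi hdeg hpot (Finset.mem_range.1 ht) hX hj.1 hj.2 hk.2 hY
  · exact avg_sum_le _ _ _ _ fun X hX => avg_sum_le _ _ _ _ fun j hj =>
      avg_sum_le _ _ _ _ fun t ht => (P.avg_phi B l hi _ _ _ _ _).le
  · exact avg_sum_le _ _ _ _ fun X hX => avg_sum_le _ _ _ _ fun j hj =>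
      (P.avg_phi B l hi _ _ _ _ _).le

/-- The chosen vector attains the minimum over the support, which is at most the average; vectors
outside the support have weight zero. -/
theorem potential_stage_le {B : ℕ → ℕ → Finset V} (hB : P.IsRun B) {l i : ℕ} (hl : l < P.T)
    (hi : i < P.s) (hdeg : P.DegBound B l) (hpot : P.potential B l i < 1) :
    P.potential B l (i + 1) ≤ P.potential B l i := by
  refine le_trans ?_ (hP.avg_potential_le hi hdeg hpot)
  rw [← avg_const P.Ω (P.potential B l (i + 1))]
  refine Finset.sum_le_sum fun b _ => ?_
  by_cases hb : b ∈ P.Ω.support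
  · exact mul_le_mul_of_nonneg_left ((hB l hl i hi).2 b hb) ENNReal.toReal_nonneg
  · rw [PMF.mem_support_iff, not_not] at hb
    simp [hb]

theorem potential_stage_lt_one {B : ℕ → ℕ → Finset V} (hB : P.IsRun B) {l : ℕ} (hl : l < P.T)
    (hdeg : P.DegBound B l) (hpot : P.potential B l 0 < 1) {i : ℕ} (hi : i ≤ P.s) :
    P.potential B l i < 1 := by
  induction i with
  | zero => exact hpot
  | succ i ih =>
    have := ih (by omega)
    exact (hP.potential_stage_le hB hl (by omega) hdeg this).trans_lt this

/-- The (S1) summands of round `l + 1` change from the placeholder `m ^ (-100)` to their true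
starting value, which `DegBound` keeps below the placeholder. -/
theorem potential_round_le {B : ℕ → ℕ → Finset V} {l : ℕ} (hdeg : P.DegBound B (l + 1)) :
    P.potential B (l + 1) 0 ≤ P.potential B l P.s := by
  rw [potential, potential]
  refine add_le_add (add_le_add ?_ ?_) ?_
  · refine Finset.sum_le_sum fun t ht => Finset.sum_le_sum fun X hX =>
      Finset.sum_le_sum fun k hk => Finset.sum_le_sum fun j hj => Finset.sum_le_sum fun Y hY => ?_
    rw [Finset.mem_Icc] at hk
    rw [Finset.mem_Ico] at hj
    rcases lt_trichotomy t (l + 1) with h | h | h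
    · exact (hP.Psi_succ_zero B (by omega) k j X Y).le
    · subst h
      refine (hP.psi_zero_le (hP.nonempty_of_mem_sets hX) hj.1 hj.2 hk.2 hdeg hY).trans ?_
      simp [Psi]
    · simp [Psi, h, (Nat.lt_succ_self l).trans h]
  · refine Finset.sum_le_sum fun X hX => Finset.sum_le_sum fun j hj =>
      Finset.sum_le_sum fun t ht => ?_
    have hj' := Finset.mem_Icc.1 hj
    have hXn := hP.nonempty_of_mem_sets hX
    exact P.phi_succ_zero_le B l _ (hP.gamma1_nonneg _ _) t hj'.1 hXn
      (hP.rate1_le_one (hP.two_le_of_mem_sets hX hj'.1))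
      (hP.rate_le_expCollapse hdeg hj'.1 (by omega) hXn)
  · refine Finset.sum_le_sum fun X hX => Finset.sum_le_sum fun j hj => ?_
    have hj' := Finset.mem_Icc.1 hj
    have hXn := hP.nonempty_of_mem_sets hX
    exact P.phi_succ_zero_le B l _ (hP.gamma2_nonneg _ _) P.T hj'.1 hXn
      (hP.rate2_le_one (hP.two_le_of_mem_sets hX hj'.1))
      (hP.rate_le_expCollapse hdeg hj'.1 (by omega) hXn)

end Admissible

end DetInput

/-! ### The initial potential and the induction over rounds -/

namespace DetInput

variable {V : Type*} [Fintype V] [DecidableEq V] (P : DetInput V)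

theorem sum_le_card_mul {ι : Type*} (s : Finset ι) (f : ι → ℝ) {c K : ℝ} (hc : 0 ≤ c)
    (hs : (s.card : ℝ) ≤ K) (h : ∀ i ∈ s, f i ≤ c) : ∑ i ∈ s, f i ≤ K * c := by
  refine (Finset.sum_le_card_nsmul s f c h).trans ?_
  rw [nsmul_eq_mul]
  exact mul_le_mul_of_nonneg_right hs hc

theorem card_filter_subset_edge_le (hr : ∀ e ∈ P.edges, e.card ≤ P.r) (A : Finset (Finset V))
    (hA : ∀ X ∈ A, ∃ e ∈ P.edges, X ⊆ e) : A.card ≤ P.m * 2 ^ P.r := by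
  have hsub : A ⊆ P.edges.biUnion Finset.powerset := by
    intro X hX
    obtain ⟨e, he, hXe⟩ := hA X hX
    exact Finset.mem_biUnion.2 ⟨e, he, Finset.mem_powerset.2 hXe⟩
  refine (Finset.card_le_card hsub).trans (Finset.card_biUnion_le.trans ?_)
  refine (Finset.sum_le_card_nsmul _ _ (2 ^ P.r) fun e he => ?_).trans (by simp [m])
  rw [Finset.card_powerset]
  exact Nat.pow_le_pow_right (by norm_num) (hr e he)

namespace Admissible

variable {P} (hP : P.Admissible)

include hP

theorem card_le_sq (A : Finset (Finset V)) (hA : ∀ X ∈ A, ∃ e ∈ P.edges, X ⊆ e) :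
    (A.card : ℝ) ≤ (P.m : ℝ) ^ 2 := by
  have h1 : (A.card : ℝ) ≤ P.m * 2 ^ P.r := by
    exact_mod_cast P.card_filter_subset_edge_le hP.rank A hA
  have h2 := hP.two_pow_r_le.trans hP.lm_le_m
  have h3 := hP.m_pos
  nlinarith

theorem degBound_zero (B : ℕ → ℕ → Finset V) : P.DegBound B 0 := by
  intro X hX j hj
  have hγ := hP.gamma1_nonneg j X.card
  rcases lt_or_ge X.card P.r with h | h
  · have := hP.constrained X hX.card_pos h j hj
    change (P.D B 0 j X : ℝ) ≤ P.gamma1 j X.card at this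
    linarith
  · rw [P.D_eq_zero_of_rank_lt hP.rank B 0 hX hj (by omega), Nat.cast_zero]
    positivity

/-- For `t = tau1` the window contains time 0, where the input being constrained makes the indicator
fail. Later windows have not begun, and the summand is `(1 - c) ^ tau1`. -/
theorem phi1_zero_le (B : ℕ → ℕ → Finset V) {X : Finset V} (hX : X ∈ P.sets) {j : ℕ}
    (hj : j ∈ Finset.Icc 1 (P.r - X.card)) {t : ℕ} (ht : P.tau1 j X.card ≤ t) :
    P.phi B 0 0 (P.tau1 j X.card) (P.gamma1 j X.card) t j X ≤ ((P.m : ℝ) ^ 100)⁻¹ := by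
  rw [Finset.mem_Icc] at hj
  have hX' := P.mem_sets.1 hX
  have h2 := hP.two_le_of_mem_sets hX hj.1
  have hτ := hP.tau1_pos h2
  have ht0 : ¬ t ≤ 0 := by omega
  rcases Nat.eq_zero_or_pos (t - P.tau1 j X.card) with h | h
  · have hD : (P.D B 0 j X : ℝ) ≤ P.gamma1 j X.card :=
      hP.constrained X hX'.1 hX'.2.1 j hj.1
    have hnot : ¬ ∀ u ∈ Finset.Icc (t - P.tau1 j X.card) 0, P.gamma1 j X.card < P.D B u j X :=
      fun hall => absurd (hall 0 (by simp [h])) (not_lt.2 hD)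
    rw [phi, if_neg ht0, if_neg (by omega), if_neg hnot]
    positivity
  · rw [phi, if_neg ht0, if_pos h]
    exact hP.one_sub_rate1_pow_le (by omega) h2

theorem phi2_zero_le (B : ℕ → ℕ → Finset V) {X : Finset V} (hX : X ∈ P.sets) {j : ℕ}
    (hj : j ∈ Finset.Icc 1 (P.r - X.card)) :
    P.phi B 0 0 (P.tau2 j X.card) (P.gamma2 j X.card) P.T j X ≤ ((P.m : ℝ) ^ 100)⁻¹ := by
  rw [Finset.mem_Icc] at hj
  have hX' := P.mem_sets.1 hX
  have hτ := hP.tau2_lt_T (k := j) (x := X.card) (by omega)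
  rw [phi, if_neg (by omega), if_pos (by omega)]
  exact hP.one_sub_rate2_pow_le (by omega) (hP.two_le_of_mem_sets hX hj.1)

theorem potential_zero_lt_one (B : ℕ → ℕ → Finset V) : P.potential B 0 0 < 1 := by
  have hm0 := hP.m_pos
  have hm : 10 ≤ (P.m : ℝ) := le_trans (by norm_num) (hP.lm_large.trans hP.lm_le_m)
  have hr : (P.r : ℝ) ≤ P.m := hP.r_le.trans hP.lm_le_m
  have hsets : (P.sets.card : ℝ) ≤ (P.m : ℝ) ^ 2 :=
    hP.card_le_sq _ fun X hX => (P.mem_sets.1 hX).2.2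
  set M : ℝ := (P.m : ℝ) with hM
  have hIcc : ∀ x : ℕ, ((Finset.Icc 1 (P.r - x)).card : ℝ) ≤ M := fun x =>
    le_trans (Nat.cast_le.2 (by rw [Nat.card_Icc]; omega)) hr
  -- The ranges of `t`, `X`, `k`, `j`, `Y` contribute `4 + 2 + 1 + 1 + 2 = 10` powers of `m`.
  have h1 : ∑ t ∈ Finset.range P.T, ∑ X ∈ P.sets, ∑ k ∈ Finset.Icc 1 P.r, ∑ j ∈ Finset.Ico 1 k,
      ∑ Y ∈ P.subsets X (k - j), P.Psi B 0 0 t k j X Y ≤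
      M ^ 4 * (M ^ 2 * (M * (M * (M ^ 2 * (M ^ 100)⁻¹)))) := by
    refine sum_le_card_mul _ _ (by positivity) (by simpa using hP.T_le) fun t ht => ?_
    refine sum_le_card_mul _ _ (by positivity) hsets fun X hX => ?_
    refine sum_le_card_mul _ _ (by positivity) (hIcc 0) fun k hk => ?_
    rw [Finset.mem_Icc] at hk
    refine sum_le_card_mul _ _ (by positivity)
      (le_trans (Nat.cast_le.2 (by rw [Nat.card_Ico]; omega)) hr) fun j hj => ?_
    rw [Finset.mem_Ico] at hj
    refine sum_le_card_mul _ _ (by positivity)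
      (hP.card_le_sq _ fun Y hY => (P.mem_subsets.1 hY).2.2) fun Y hY => ?_
    rcases Nat.eq_zero_or_pos t with rfl | h
    · exact hP.psi_zero_le (hP.nonempty_of_mem_sets hX) hj.1 hj.2 hk.2 (hP.degBound_zero B) hY
    · simp [Psi, h, hM]
  have h2 : ∑ X ∈ P.sets, ∑ j ∈ Finset.Icc 1 (P.r - X.card),
      ∑ t ∈ Finset.Icc (P.tau1 j X.card) P.T,
      P.phi B 0 0 (P.tau1 j X.card) (P.gamma1 j X.card) t j X ≤
      M ^ 2 * (M * ((M ^ 4 + 1) * (M ^ 100)⁻¹)) := by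
    refine sum_le_card_mul _ _ (by positivity) hsets fun X hX => ?_
    refine sum_le_card_mul _ _ (by positivity) (hIcc X.card) fun j hj => ?_
    refine sum_le_card_mul _ _ (by positivity) ?_ fun t ht =>
      hP.phi1_zero_le B hX hj (Finset.mem_Icc.1 ht).1
    have hc : (Finset.Icc (P.tau1 j X.card) P.T).card ≤ P.T + 1 := by
      rw [Nat.card_Icc]
      omega
    calc ((Finset.Icc (P.tau1 j X.card) P.T).card : ℝ) ≤ ((P.T + 1 : ℕ) : ℝ) := Nat.cast_le.2 hc
      _ ≤ M ^ 4 + 1 := by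
          push_cast
          linarith [hP.T_le]
  have h3 : ∑ X ∈ P.sets, ∑ j ∈ Finset.Icc 1 (P.r - X.card),
      P.phi B 0 0 (P.tau2 j X.card) (P.gamma2 j X.card) P.T j X ≤
      M ^ 2 * (M * (M ^ 100)⁻¹) := by
    refine sum_le_card_mul _ _ (by positivity) hsets fun X hX => ?_
    exact sum_le_card_mul _ _ (by positivity) (hIcc X.card) fun j hj => hP.phi2_zero_le B hX hj
  rw [potential]
  refine lt_of_le_of_lt (add_le_add (add_le_add h1 h2) h3) ?_
  have hM1 : 1 ≤ M := by linarith
  have e1 : M ^ 7 ≤ M ^ 10 := pow_le_pow_right₀ hM1 (by norm_num)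
  have e2 : M ^ 3 ≤ M ^ 10 := pow_le_pow_right₀ hM1 (by norm_num)
  have e3 : M ^ 11 ≤ M ^ 100 := pow_le_pow_right₀ hM1 (by norm_num)
  have e4 : 0 < M ^ 10 := by positivity
  have e5 : M ^ 11 = M * M ^ 10 := by ring
  calc _ = (M ^ 10 + M ^ 7 + 2 * M ^ 3) / M ^ 100 := by field_simp; ring
    _ < 1 := by
        rw [div_lt_one (by positivity)]
        nlinarith

/-- The case `k = j + 1` gives the exponent `4 + 1 = 5` exactly. As `g` grows exponentially, every
larger `k` is smaller by at least a factor `log m`; there are at most `r ≤ log m` of these. -/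
theorem increment_exponent_le {j k x : ℕ} (hx : 1 ≤ x) (hj : 1 ≤ j) (hjk : j < k) :
    P.lm ^ (-gExp (k + x) + 4 * ((k - j : ℕ) : ℝ) + 1) ≤
      P.lm ^ (-gExp (x + j + 1) + 5) * ((if k = j + 1 then 1 else 0) + P.lm⁻¹) := by
  have h0 := hP.lm_pos
  obtain ⟨p, rfl⟩ : ∃ p, k = j + 1 + p := ⟨k - (j + 1), by omega⟩
  have hc : ((j + 1 + p - j : ℕ) : ℝ) = p + 1 := by
    rw [show j + 1 + p - j = p + 1 by omega]
    push_cast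
    ring
  rw [hc]
  rcases Nat.eq_zero_or_pos p with rfl | hp
  · have he : -gExp (j + 1 + 0 + x) + 4 * (((0 : ℕ) : ℝ) + 1) + 1 = -gExp (x + j + 1) + 5 := by
      rw [show j + 1 + 0 + x = x + j + 1 by omega]
      push_cast
      ring
    rw [he]
    simp only [add_zero, if_true]
    exact le_mul_of_one_le_right (by positivity) (by
      have : 0 ≤ P.lm⁻¹ := by positivity
      linarith)
  · rw [if_neg (by omega), zero_add, ← Real.rpow_neg_one, ← Real.rpow_add h0]
    refine hP.lm_rpow_le ?_
    have hpow : (2 : ℝ) ^ (j + 1 + p + x + 2) = 2 ^ (x + j + 1 + 2) * 2 ^ p := by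
      rw [← pow_add]
      congr 1
      omega
    have h32 : (32 : ℝ) ≤ 2 ^ (x + j + 1 + 2) := by
      calc (32 : ℝ) = 2 ^ 5 := by norm_num
        _ ≤ _ := pow_le_pow_right₀ (by norm_num) (by omega)
    have h2p : (p : ℝ) + 1 ≤ 2 ^ p := by
      exact_mod_cast Nat.lt_two_pow_self
    have hp1 : (1 : ℝ) ≤ p := by exact_mod_cast hp
    rw [gExp, gExp, hpow]
    nlinarith

/-- A potential below 1 bounds the growth of the degrees in each past or current round. -/
theorem D_succ_le_of_potential {B : ℕ → ℕ → Finset V} {l u : ℕ} (hu : u ≤ l) (huT : u < P.T)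
    (hpot : P.potential B l P.s < 1) {X : Finset V} (hX : X ∈ P.sets) {j : ℕ} (hj : 1 ≤ j) :
    (P.D B (u + 1) j X : ℝ) ≤
      P.D B u j X + P.v ^ j * P.lm ^ (-gExp (X.card + j + 1) + 5.01) := by
  have h0 := hP.lm_pos
  have hv := hP.v_pos
  have hX' := P.mem_sets.1 hX
  refine (P.D_succ_le hP.rank B u (hP.nonempty_of_mem_sets hX) hj).trans ?_
  refine add_le_add le_rfl ?_
  have hterm : ∀ k ∈ Finset.Ioc j P.r, P.H B u j (k - j) X P.s ∅ ≤
      P.v ^ j * (P.lm ^ (-gExp (X.card + j + 1) + 5) *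
        ((if k = j + 1 then 1 else 0) + P.lm⁻¹)) := by
    intro k hk
    rw [Finset.mem_Ioc] at hk
    obtain ⟨e, he, -⟩ := hX'.2.2
    have hmem : ∅ ∈ P.subsets X (k - j) :=
      P.mem_subsets.2 ⟨Finset.disjoint_empty_right X, by rw [Finset.card_empty]; omega,
        e, he, Finset.empty_subset e⟩
    have hΨ := (hP.Psi_le_potential B l P.s huT hX hj hk.1 hk.2 hmem).trans_lt hpot
    -- A past summand is frozen at its value after the last stage of its own round.
    have hΨ' : P.Psi B u P.s u k j X ∅ < 1 := by
      rcases hu.lt_or_eq with h | rfl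
      · rwa [hP.Psi_past B h, ← hP.Psi_past B (Nat.lt_succ_self u) 0, hP.Psi_succ_zero B le_rfl]
          at hΨ
      · exact hΨ
    have hH := hP.H_scaled_lt_of_Psi_lt_one hk.1 hΨ'
    rw [Nat.sub_self, zero_mul, pow_zero, inv_one, mul_one, ← hP.psiBase_mul_lm,
      Finset.card_empty, Nat.sub_zero] at hH
    exact hH.trans (mul_le_mul_of_nonneg_left
      (hP.increment_exponent_le hX'.1 hj hk.1) (by positivity))
  refine (Finset.sum_le_sum hterm).trans ?_
  rw [← Finset.mul_sum, ← Finset.mul_sum]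
  refine mul_le_mul_of_nonneg_left ?_ (by positivity)
  have hsum : ∑ k ∈ Finset.Ioc j P.r, ((if k = j + 1 then (1 : ℝ) else 0) + P.lm⁻¹) ≤ 2 := by
    rw [Finset.sum_add_distrib, Finset.sum_const, nsmul_eq_mul, Nat.card_Ioc,
      Finset.sum_ite_eq']
    have h1 : ((P.r - j : ℕ) : ℝ) * P.lm⁻¹ ≤ 1 := by
      rw [← div_eq_mul_inv, div_le_one h0]
      exact le_trans (Nat.cast_le.2 (Nat.sub_le _ _)) hP.r_le
    have h2 : (if j + 1 ∈ Finset.Ioc j P.r then (1 : ℝ) else 0) ≤ 1 := by split_ifs <;> norm_num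
    linarith
  calc P.lm ^ (-gExp (X.card + j + 1) + 5) *
        ∑ k ∈ Finset.Ioc j P.r, ((if k = j + 1 then (1 : ℝ) else 0) + P.lm⁻¹) ≤
      P.lm ^ (-gExp (X.card + j + 1) + 5) * P.lm ^ (0.01 : ℝ) :=
        mul_le_mul_of_nonneg_left (hsum.trans (by linarith [hP.four_le_lm_rpow])) (by positivity)
    _ = P.lm ^ (-gExp (X.card + j + 1) + 5.01) := by
        rw [← Real.rpow_add h0]
        norm_num [add_assoc]

/-- The degree was at most `gamma1` at some recent time, and the per-round growth bound over the at
most `tau1 + 1` rounds since then adds at most twice `gamma1`. -/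
theorem degBound_succ {B : ℕ → ℕ → Finset V} {l : ℕ} (hl : l < P.T)
    (hpot : P.potential B l P.s < 1) : P.DegBound B (l + 1) := by
  intro X hXn j hj
  have h0 := hP.lm_pos
  have hv := hP.v_pos
  have hγ := hP.gamma1_nonneg j X.card
  by_cases hzero : P.r < X.card + j
  · rw [P.D_eq_zero_of_rank_lt hP.rank B _ hXn hj hzero, Nat.cast_zero]
    positivity
  by_cases hedge : ∃ e ∈ P.edges, X ⊆ e
  swap
  · push Not at hedge
    rw [P.D_eq_zero_of_not_subset B _ hXn hj hedge, Nat.cast_zero]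
    positivity
  have hX : X ∈ P.sets := P.mem_sets.2 ⟨hXn.card_pos, by omega, hedge⟩
  have hstart : ∃ u ≤ l, l ≤ u + P.tau1 j X.card ∧ (P.D B u j X : ℝ) ≤ P.gamma1 j X.card := by
    rcases Nat.lt_or_ge l (P.tau1 j X.card) with h | h
    · exact ⟨0, Nat.zero_le _, by omega, hP.constrained X hXn.card_pos (by omega) j hj⟩
    · have hφ := (hP.phi1_le_potential B l P.s hX (Finset.mem_Icc.2 ⟨hj, by omega⟩) h
        hl.le).trans_lt hpot
      -- For the summand ending at time `l` the value is already the 0/1 indicator, so being below 1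
      -- means that the window contains a time of low degree.
      rw [phi, if_pos le_rfl] at hφ
      have hnot : ¬ ∀ u ∈ Finset.Icc (l - P.tau1 j X.card) l,
          P.gamma1 j X.card < P.D B u j X := by
        intro hall
        rw [if_pos hall] at hφ
        exact lt_irrefl _ hφ
      push Not at hnot
      obtain ⟨u, hu, hDu⟩ := hnot
      rw [Finset.mem_Icc] at hu
      exact ⟨u, hu.2, by omega, hDu⟩
  obtain ⟨u, hul, hτ, hDu⟩ := hstart
  set δ := P.v ^ j * P.lm ^ (-gExp (X.card + j + 1) + 5.01) with hδ
  have hδ0 : 0 ≤ δ := by positivity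
  have hgrow : ∀ a, u + a ≤ l + 1 → (P.D B (u + a) j X : ℝ) ≤ P.D B u j X + a * δ := by
    intro a
    induction a with
    | zero => simp
    | succ a ih =>
      intro ha
      have h1 := ih (by omega)
      have h2 := hP.D_succ_le_of_potential (u := u + a) (by omega) (by omega) hpot hX hj
      rw [← hδ] at h2
      rw [← add_assoc]
      push_cast
      linarith
  have h1 := hgrow (l + 1 - u) (by omega)
  rw [show u + (l + 1 - u) = l + 1 by omega] at h1
  have h2 : ((l + 1 - u : ℕ) : ℝ) ≤ P.tau1 j X.card + 1 := by
    exact_mod_cast (by omega : l + 1 - u ≤ P.tau1 j X.card + 1)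
  have h3 := hP.tau1_succ_mul_le hj X.card
  rw [← hδ] at h3
  have h4 := mul_le_mul_of_nonneg_right h2 hδ0
  linarith

/-- Both facts must be proved together: a potential below 1 at the end of a round yields the next
degree bound, which is needed for the passage to the next potential. -/
theorem round_invariant {B : ℕ → ℕ → Finset V} (hB : P.IsRun B) {l : ℕ} (hl : l < P.T) :
    P.DegBound B l ∧ P.potential B l 0 < 1 := by
  induction l with
  | zero => exact ⟨hP.degBound_zero B, hP.potential_zero_lt_one B⟩
  | succ l ih =>
    obtain ⟨hdeg, hpot⟩ := ih (by omega)
    have h1 := hP.potential_stage_lt_one hB (by omega) hdeg hpot le_rfl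
    have h2 := hP.degBound_succ (by omega) h1
    exact ⟨h2, (hP.potential_round_le h2).trans_lt h1⟩

theorem D_succ_le_of_isRun {B : ℕ → ℕ → Finset V} (hB : P.IsRun B) {t : ℕ} (ht : t < P.T)
    {X : Finset V} (hX0 : 0 < X.card) (hXr : X.card < P.r) {j : ℕ} (hj : 1 ≤ j) :
    (P.D B (t + 1) j X : ℝ) ≤
      P.D B t j X + P.v ^ j * P.lm ^ (-gExp (X.card + j + 1) + 5.01) := by
  obtain ⟨hdeg, hpot⟩ := hP.round_invariant hB ht
  have h1 := hP.potential_stage_lt_one hB ht hdeg hpot le_rfl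
  by_cases hedge : ∃ e ∈ P.edges, X ⊆ e
  · exact hP.D_succ_le_of_potential le_rfl ht h1 (P.mem_sets.2 ⟨hX0, hXr, hedge⟩) hj
  · push Not at hedge
    have h0 := hP.lm_pos
    have hv := hP.v_pos
    rw [P.D_eq_zero_of_not_subset B _ (Finset.card_pos.1 hX0) hj hedge, Nat.cast_zero]
    positivity

end Admissible

/-- For `v ≤ 1` a constrained hypergraph has no edges with two or more vertices. -/
theorem card_le_one_of_v_le_one (hr : ∀ e ∈ P.edges, e.card ≤ P.r) (hv0 : 0 < P.v)
    (hv : P.v ≤ 1) (hlm : 1 < P.lm) (hc : IsConstrained P.m P.r P.edges P.v) {e : Finset V}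
    (he : e ∈ P.edges) : e.card ≤ 1 := by
  by_contra hlt
  push Not at hlt
  obtain ⟨u, hu⟩ := Finset.card_pos.1 (zero_lt_one.trans hlt)
  have hre := hr e he
  have h1 := hc {u} (by simp) (by rw [Finset.card_singleton]; omega) (e.card - 1) (by omega)
  have hmem : e \ {u} ∈ nbhd P.edges (e.card - 1) {u} := by
    refine mem_nbhd.2 ⟨Finset.disjoint_sdiff, ?_, ?_⟩
    · rwa [Finset.union_sdiff_of_subset (Finset.singleton_subset_iff.2 hu)]
    · rw [Finset.card_sdiff_of_subset (Finset.singleton_subset_iff.2 hu), Finset.card_singleton]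
  have h2 : (1 : ℝ) ≤ hdeg P.edges (e.card - 1) {u} := by
    exact_mod_cast Finset.card_pos.2 ⟨_, hmem⟩
  have h3 : P.lm ^ (-gExp (e.card - 1 + ({u} : Finset V).card)) < 1 := by
    refine Real.rpow_lt_one_of_one_lt_of_neg hlm ?_
    have := seven_le_gExp (l := e.card - 1 + ({u} : Finset V).card)
      (by rw [Finset.card_singleton]; omega)
    linarith
  have h4 : P.v ^ (e.card - 1) ≤ 1 := pow_le_one₀ hv0.le hv
  have h5 : 0 < P.v ^ (e.card - 1) := by positivity
  change _ ≤ P.v ^ (e.card - 1) * P.lm ^ (-gExp (e.card - 1 + ({u} : Finset V).card)) at h1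
  nlinarith

theorem D_eq_zero_of_card_le_one (h : ∀ e ∈ P.edges, e.card ≤ 1) (B : ℕ → ℕ → Finset V) (t : ℕ)
    {X : Finset V} (hX : X.Nonempty) {j : ℕ} (hj : 1 ≤ j) : P.D B t j X = 0 := by
  rw [D, hdeg, Finset.card_eq_zero, Finset.eq_empty_iff_forall_notMem]
  intro Y hY
  obtain ⟨f, hf, hsub⟩ := P.exists_edge_superset_of_mem_nbhd hX hj hY
  obtain ⟨hXY, _, hYj⟩ := mem_nbhd.1 hY
  have h1 := two_le_card_union hX (by omega) hXY
  have h2 := Finset.card_le_card hsub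
  have h3 := h f hf
  omega

end DetInput

theorem theorem5p8 :
    ∃ L₀ : ℝ, 0 < L₀ ∧ ∃ N₀ : ℕ,
      ∀ (V : Type*) [Fintype V] [DecidableEq V] (P : DetInput V),
        N₀ ≤ Fintype.card V →
        Fintype.card V ≤ P.m →
        (2 : ℝ) ^ P.r ≤
          Real.log (Fintype.card V) / Real.log (Real.log (Fintype.card V)) →
        (∀ e ∈ P.edges, e.card ≤ P.r) →
        0 < P.v → P.v ≤ (P.m : ℝ) ^ 3 →
        IsConstrained P.m P.r P.edges P.v →
        ApproxIndep P.Ω (L₀ * Real.log P.m) →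
        EdgeIndep P.Ω P.edges →
        ∀ B : ℕ → ℕ → Finset V, P.IsRun B →
        ∀ t < P.T, ∀ X : Finset V, 0 < X.card → X.card < P.r → ∀ j : ℕ, 1 ≤ j →
          (P.D B (t + 1) j X : ℝ) ≤
            P.D B t j X + P.v ^ j * Real.log P.m ^ (-gExp (X.card + j + 1) + 5.01) := by
  -- The first constant covers the positions in the moments, the second makes `log m ≥ log n ≥ 2 ^
  -- 200`.
  refine ⟨1001, by norm_num, ⌈Real.exp (2 ^ 200)⌉₊, ?_⟩
  intro V _ _ P hN hnm hr hrank hv0 hv hc hind hedge B hB t ht X hX0 hXr j hj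
  have hn : Real.exp (2 ^ 200) ≤ (Fintype.card V : ℝ) :=
    (Nat.le_ceil _).trans (Nat.cast_le.2 hN)
  have hn0 : (0 : ℝ) < Fintype.card V := (Real.exp_pos _).trans_le hn
  have hlogn : 2 ^ 200 ≤ Real.log (Fintype.card V) := (Real.le_log_iff_exp_le hn0).2 hn
  have hlog : Real.log (Fintype.card V) ≤ P.lm := Real.log_le_log hn0 (Nat.cast_le.2 hnm)
  have hlm : 2 ^ 200 ≤ P.lm := hlogn.trans hlog
  have hlm1 : 1 < P.lm := lt_of_lt_of_le (by norm_num) hlm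
  change (P.D B (t + 1) j X : ℝ) ≤
    P.D B t j X + P.v ^ j * P.lm ^ (-gExp (X.card + j + 1) + 5.01)
  rcases le_or_gt P.v 1 with hv1 | hv1
  · rw [P.D_eq_zero_of_card_le_one
      (fun e he => P.card_le_one_of_v_le_one hrank hv0 hv1 hlm1 hc he) B _
      (Finset.card_pos.1 hX0) hj, Nat.cast_zero]
    have : 0 < P.lm := zero_lt_one.trans hlm1
    positivity
  · have hpow : 2 ^ P.r * Real.log P.lm ≤ P.lm := by
      have he : Real.exp 1 ≤ Real.log (Fintype.card V) :=
        Real.exp_one_lt_d9.le.trans (le_trans (by norm_num) hlogn)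
      -- `log y / y` decreases for `y ≥ e`, so the bound on `2 ^ r` in terms of `n` passes to `m ≥
      -- n`.
      have hanti : Real.log P.lm / P.lm ≤
          Real.log (Real.log (Fintype.card V)) / Real.log (Fintype.card V) :=
        Real.log_div_self_antitoneOn he (he.trans hlog) hlog
      have hl0 : 0 < Real.log (Fintype.card V) := (Real.exp_pos 1).trans_le he
      have hlm0 : 0 < P.lm := hl0.trans_le hlog
      have hll : 0 < Real.log (Real.log (Fintype.card V)) :=
        Real.log_pos (lt_of_lt_of_le (by norm_num) hlogn)
      rw [le_div_iff₀ hll] at hr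
      have h1 : 2 ^ P.r * (Real.log P.lm / P.lm) ≤ 1 := by
        refine (mul_le_mul_of_nonneg_left hanti (by positivity)).trans ?_
        rw [← mul_div_assoc, div_le_one hl0]
        exact hr
      rw [← mul_div_assoc, div_le_one hlm0] at h1
      exact h1
    have hP : P.Admissible := ⟨hrank, hv1, hv, hc, hind, hedge, hlm, hpow⟩
    exact hP.D_succ_le_of_isRun hB ht hX0 hXr hj
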